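/- Let $\mathbb F$ be an arbitrary field and $n\ge 0$. The 0-Hecke algebra $H_n(0)$ is the unital associative $\mathbb F$-algebra generated by $\pi_1,\dots,\pi_{n-1}$ with relations $\pi_i^2=\pi_i$, $\pi_i\pi_{i+1}\pi_i=\pi_{i+1}\pi_i\pi_{i+1}$, and $\pi_i\pi_j=\pi_j\pi_i$ for $|i-j|>1$. Put $\overline\pi_i=\pi_i-1$, and for $w\in\mathfrak S_n$ put $\overline\pi_w=\overline\pi_{i_1}\cdots\overline\pi_{i_k}$ where $w=s_{i_1}\cdots s_{i_k}$ is any reduced expression in the adjacent transpositions $s_i=(i,i+1)$ (this does not depend on the expression). The algebra $H_n(0)$ acts on $\mathbb F[x_1,\dots,x_n]$ by the Demazure operators $$\pi_i f=\frac{x_i f-x_{i+1}s_i(f)}{x_i-x_{i+1}},$$ where $s_i$ exchanges the variables $x_i$ and $x_{i+1}$. Let $\alpha=(\alpha_1,\dots,\alpha_\ell)$ be a composition of $n$, let $D(\alpha)=\{\alpha_1,\alpha_1+\alpha_2,\dots,\alpha_1+\cdots+\alpha_{\ell-1}\}$, and let $x_\alpha=\prod_{i\in D(\alpha)}x_1\cdots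 x_i$. For $w\in\mathfrak S_n$ let $D(w)=\{i\in\{1,\dots,n-1\}: w(i)>w(i+1)\}$. Let $\alpha_1\oplus\cdots\oplus\alpha_\ell$ be the skew diagram whose connected components are single rows of lengths $\alpha_1,\dots,\alpha_\ell$, from bottom to top, each strictly to the northeast of the preceding one. Let $\mathbf M_\alpha$ be the $\mathbb F$-vector space with basis the standard tableaux of this shape (bijective fillings with $1,\dots,n$ that increase from left to right in rows and from top to bottom in columns), on which $H_n(0)$ acts by $$\overline\pi_i(\tau)=\begin{cases}-\tau,& i \text{ is in a higher row of }\tau\text{ than } i+1,\\ 0,& i\text{ is in the same row of }\tau\text{ as }i+1,\\ s_i(\tau),& i\text{ is in a lower row of }\tau\text{ than }i+1,\end{cases}$$ where $s_i(\tau)$ is obtained from $\tau$ by exchanging the entries $i$ and $i+1$. Then the $H_n(0)$-submodule $H_n(0)x_\alpha$ of $\mathbb F[x_1,\dots,x_n]$ generated by $x_\alpha$ has the $\mathbb F$-basis $\{\overline\pi_w x_\alpha: w\in\mathfrak S_n,\ D(w)\subseteq D(\alpha)\}$ (the listed elements being distinct for distinct $w$), and it is isomorphic to $\mathbf M_\alpha$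 as an $H_n(0)$-module. -/

import Mathlib

namespace HeckePoly

/-! ### The symmetric group

The generators `s_1, …, s_{n-1}` are indexed by `Fin (n - 1)`: the index `i` (counted from zero)
stands for the adjacent transposition of the positions `i` and `i + 1` of `Fin n`. -/

/-- The first of the two positions moved by `s i`. -/
def lo {n : ℕ} (i : Fin (n - 1)) : Fin n := ⟨i.1, by omega⟩

/-- The second of the two positions moved by `s i`. -/
def hi {n : ℕ} (i : Fin (n - 1)) : Fin n := ⟨i.1 + 1, by omega⟩

/-- The adjacent transposition `s i`. -/
def s {n : ℕ} (i : Fin (n - 1)) : Equiv.Perm (Fin n) := Equiv.swap (lo i) (hi i)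

/-- `l` is a reduced expression of `w`: the product of the `s i`, `i ∈ l`, is `w` and no shorter
list has this property. -/
def IsReducedWord {n : ℕ} (l : List (Fin (n - 1))) (w : Equiv.Perm (Fin n)) : Prop :=
  (l.map s).prod = w ∧ ∀ l' : List (Fin (n - 1)), (l'.map s).prod = w → l.length ≤ l'.length

/-- The descent set `D(w)` of a permutation. -/
def permDescents {n : ℕ} (w : Equiv.Perm (Fin n)) : Set (Fin (n - 1)) :=
  {i | w (hi i) < w (lo i)}

/-- The descent set `D(α) = {α_1, α_1 + α_2, …, α_1 + ⋯ + α_{ℓ-1}}` of a composition. The index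
`i : Fin (n - 1)`, counted from zero, stands for the element `i + 1` of `{1, …, n - 1}`. -/
def compDescents {n : ℕ} (α : Composition n) : Set (Fin (n - 1)) :=
  {i | ∃ k : ℕ, 0 < k ∧ k < α.length ∧ α.sizeUpTo k = i.1 + 1}

/-! ### The 0-Hecke algebra -/

/-- The defining relations of the 0-Hecke algebra of type `A`. -/
inductive HeckeRel (F : Type*) [Field F] (n : ℕ) :
    FreeAlgebra F (Fin (n - 1)) → FreeAlgebra F (Fin (n - 1)) → Prop
  | idem (i : Fin (n - 1)) :
      HeckeRel F n (FreeAlgebra.ι F i * FreeAlgebra.ι F i) (FreeAlgebra.ι F i)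
  | braid (i j : Fin (n - 1)) (h : i.1 + 1 = j.1) :
      HeckeRel F n (FreeAlgebra.ι F i * FreeAlgebra.ι F j * FreeAlgebra.ι F i)
        (FreeAlgebra.ι F j * FreeAlgebra.ι F i * FreeAlgebra.ι F j)
  | comm (i j : Fin (n - 1)) (h : i.1 + 1 < j.1) :
      HeckeRel F n (FreeAlgebra.ι F i * FreeAlgebra.ι F j)
        (FreeAlgebra.ι F j * FreeAlgebra.ι F i)

/-- The 0-Hecke algebra `H_n(0)` over the field `F`. -/
def ZeroHecke (F : Type*) [Field F] (n : ℕ) := RingQuot (HeckeRel F n)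

section Algebra

variable (F : Type*) [Field F] (n : ℕ)

noncomputable instance : Ring (ZeroHecke F n) := inferInstanceAs (Ring (RingQuot _))

noncomputable instance : Algebra F (ZeroHecke F n) := inferInstanceAs (Algebra F (RingQuot _))

variable {n}

/-- The generator `π_i` of `H_n(0)`. -/
noncomputable def gen (i : Fin (n - 1)) : ZeroHecke F n :=
  RingQuot.mkAlgHom F (HeckeRel F n) (FreeAlgebra.ι F i)

/-- The generator `π̄_i = π_i - 1` of `H_n(0)`. -/
noncomputable def genBar (i : Fin (n - 1)) : ZeroHecke F n := gen F i - 1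

theorem gen_idem (i : Fin (n - 1)) : gen F i * gen F i = gen F i := by
  have h := RingQuot.mkAlgHom_rel F (HeckeRel.idem (F := F) (n := n) i)
  rw [map_mul] at h
  exact h

theorem gen_braid {i j : Fin (n - 1)} (hij : i.1 + 1 = j.1) :
    gen F i * gen F j * gen F i = gen F j * gen F i * gen F j := by
  have h := RingQuot.mkAlgHom_rel F (HeckeRel.braid (F := F) (n := n) i j hij)
  rw [map_mul, map_mul, map_mul, map_mul] at h
  exact h

theorem gen_comm {i j : Fin (n - 1)} (hij : i.1 + 1 < j.1) :
    gen F i * gen F j = gen F j * gen F i := by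
  have h := RingQuot.mkAlgHom_rel F (HeckeRel.comm (F := F) (n := n) i j hij)
  rw [map_mul, map_mul] at h
  exact h

/-- Operators that satisfy the defining relations give an algebra homomorphism. -/
noncomputable def liftHecke {A : Type*} [Ring A] [Algebra F A] (p : Fin (n - 1) → A)
    (h1 : ∀ i, p i * p i = p i)
    (h2 : ∀ i j : Fin (n - 1), i.1 + 1 = j.1 → p i * p j * p i = p j * p i * p j)
    (h3 : ∀ i j : Fin (n - 1), i.1 + 1 < j.1 → p i * p j = p j * p i) :
    ZeroHecke F n →ₐ[F] A :=
  RingQuot.liftAlgHom F ⟨FreeAlgebra.lift F p, by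
    intro x y h
    induction h with
    | idem i => simpa using h1 i
    | braid i j hij => simpa using h2 i j hij
    | comm i j hij => simpa using h3 i j hij⟩

theorem liftHecke_gen {A : Type*} [Ring A] [Algebra F A] (p : Fin (n - 1) → A)
    (h1 : ∀ i, p i * p i = p i)
    (h2 : ∀ i j : Fin (n - 1), i.1 + 1 = j.1 → p i * p j * p i = p j * p i * p j)
    (h3 : ∀ i j : Fin (n - 1), i.1 + 1 < j.1 → p i * p j = p j * p i) (i : Fin (n - 1)) :
    liftHecke F p h1 h2 h3 (gen F i) = p i := by
  unfold liftHecke gen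
  erw [RingQuot.liftAlgHom_mkAlgHom_apply]
  simp

theorem genBar_braid {i j : Fin (n - 1)} (hij : i.1 + 1 = j.1) :
    genBar F i * genBar F j * genBar F i = genBar F j * genBar F i * genBar F j := by
  have h1 := gen_idem F i
  have h2 := gen_idem F j
  have h3 := gen_braid F hij
  have e1 : genBar F i * genBar F j * genBar F i = gen F i * gen F j * gen F i
      - gen F i * gen F j - gen F j * gen F i - gen F i * gen F i
      + gen F i + gen F i + gen F j - 1 := by
    unfold genBar; noncomm_ring
  have e2 : genBar F j * genBar F i * genBar F j = gen F j * gen F i * gen F j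
      - gen F j * gen F i - gen F i * gen F j - gen F j * gen F j
      + gen F j + gen F j + gen F i - 1 := by
    unfold genBar; noncomm_ring
  rw [e1, e2, h1, h2, h3]
  abel

theorem genBar_comm {i j : Fin (n - 1)} (hij : i.1 + 1 < j.1) :
    genBar F i * genBar F j = genBar F j * genBar F i := by
  have h3 := gen_comm F hij
  have e1 : genBar F i * genBar F j = gen F i * gen F j - gen F i - gen F j + 1 := by
    unfold genBar; noncomm_ring
  have e2 : genBar F j * genBar F i = gen F j * gen F i - gen F j - gen F i + 1 := by
    unfold genBar; noncomm_ring
  rw [e1, e2, h3]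
  abel

end Algebra

/-! ### Reduced words: the elements `π̄_w` are well defined -/

section Words

variable {n : ℕ}

/-- The set of inversions of a permutation. -/
def invSet (w : Equiv.Perm (Fin n)) : Finset (Fin n × Fin n) :=
  Finset.univ.filter fun p => p.1 < p.2 ∧ w p.2 < w p.1

theorem s_mul_self (i : Fin (n - 1)) : (s i : Equiv.Perm (Fin n)) * s i = 1 :=
  Equiv.swap_mul_self _ _

theorem s_s (i : Fin (n - 1)) (x : Fin n) : s i (s i x) = x := by
  rw [← Equiv.Perm.mul_apply, s_mul_self, Equiv.Perm.one_apply]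

theorem mul_s_s (w : Equiv.Perm (Fin n)) (i : Fin (n - 1)) : w * s i * s i = w := by
  rw [mul_assoc, s_mul_self, mul_one]

theorem s_lo (i : Fin (n - 1)) : s i (lo i) = hi i := Equiv.swap_apply_left _ _

theorem s_hi (i : Fin (n - 1)) : s i (hi i) = lo i := Equiv.swap_apply_right _ _

theorem lo_lt_hi (i : Fin (n - 1)) : lo i < hi i := by simp [lo, hi, Fin.lt_def]

theorem s_val (i : Fin (n - 1)) (x : Fin n) :
    (s i x).1 = if x.1 = i.1 then i.1 + 1 else if x.1 = i.1 + 1 then i.1 else x.1 := by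
  unfold s
  rw [Equiv.swap_apply_def]
  simp only [lo, hi, Fin.ext_iff]
  split_ifs <;> rfl

theorem s_lt {i : Fin (n - 1)} {a b : Fin n} (h : a < b) (h' : ¬ (a = lo i ∧ b = hi i)) :
    s i a < s i b := by
  rw [Fin.lt_def, s_val, s_val]
  rw [Fin.lt_def] at h
  simp only [lo, hi, Fin.ext_iff] at h'
  split_ifs <;> omega

theorem s_fix {i : Fin (n - 1)} {x : Fin n} (h1 : x.1 ≠ i.1) (h2 : x.1 ≠ i.1 + 1) : s i x = x := by
  ext
  rw [s_val, if_neg h1, if_neg h2]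

theorem s_comm {i j : Fin (n - 1)} (h : i.1 + 1 < j.1) :
    (s i : Equiv.Perm (Fin n)) * s j = s j * s i := by
  ext x
  simp only [Equiv.Perm.mul_apply, s_val]
  split_ifs <;> omega

theorem s_braid {i j : Fin (n - 1)} (h : i.1 + 1 = j.1) :
    (s i : Equiv.Perm (Fin n)) * s j * s i = s j * s i * s j := by
  have hm : lo j = hi i := by ext; simp [hi, lo, h]
  have h1 : lo i ≠ hi i := (lo_lt_hi i).ne
  have h2 : hi i ≠ hi j := hm ▸ (lo_lt_hi j).ne
  have h3 : lo i ≠ hi j := ((lo_lt_hi i).trans (hm ▸ lo_lt_hi j)).ne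
  unfold s
  rw [hm, Equiv.swap_mul_swap_mul_swap h1 h3, Equiv.swap_comm (lo i) (hi i),
    Equiv.swap_comm (hi i) (hi j), Equiv.swap_mul_swap_mul_swap h2.symm h3.symm, Equiv.swap_comm]

theorem mem_invSet {w : Equiv.Perm (Fin n)} {a b : Fin n} :
    (a, b) ∈ invSet w ↔ a < b ∧ w b < w a := by
  unfold invSet
  rw [Finset.mem_filter]
  simp

theorem card_invSet_asc {w : Equiv.Perm (Fin n)} {i : Fin (n - 1)} (h : w (lo i) < w (hi i)) :
    (invSet (w * s i)).card = (invSet w).card + 1 := by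
  have e : invSet (w * s i) =
      insert (lo i, hi i) ((invSet w).image fun p => (s i p.1, s i p.2)) := by
    ext ⟨a, b⟩
    simp only [mem_invSet, Finset.mem_insert, Finset.mem_image, Prod.exists, Prod.mk.injEq, Equiv.Perm.mul_apply]
    constructor
    · rintro ⟨h1, h2⟩
      by_cases hab : a = lo i ∧ b = hi i
      · exact Or.inl hab
      · exact Or.inr ⟨s i a, s i b, ⟨s_lt h1 hab, h2⟩, s_s i a, s_s i b⟩
    · rintro (⟨rfl, rfl⟩ | ⟨c, d, ⟨h1, h2⟩, rfl, rfl⟩)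
      · exact ⟨lo_lt_hi i, by rwa [s_lo, s_hi]⟩
      · refine ⟨s_lt h1 ?_, by rwa [s_s, s_s]⟩
        rintro ⟨rfl, rfl⟩
        exact absurd h (not_lt_of_gt h2)
  have inj : Function.Injective fun p : Fin n × Fin n => (s i p.1, s i p.2) := by
    rintro ⟨a, b⟩ ⟨c, d⟩ hh
    simpa using hh
  rw [e, Finset.card_insert_of_notMem, Finset.card_image_of_injective _ inj]
  simp only [mem_invSet, Finset.mem_image, Prod.exists, Prod.mk.injEq, not_exists, not_and]
  rintro a b ⟨h1, -⟩ h3 h4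
  have ha : a = hi i := by rw [← s_s i a, h3, s_lo]
  have hb : b = lo i := by rw [← s_s i b, h4, s_hi]
  rw [ha, hb] at h1
  exact absurd h1 (not_lt_of_gt (lo_lt_hi i))

theorem card_invSet_desc {w : Equiv.Perm (Fin n)} {i : Fin (n - 1)} (h : w (hi i) < w (lo i)) :
    (invSet w).card = (invSet (w * s i)).card + 1 := by
  have := card_invSet_asc (w := w * s i) (i := i)
    (by simpa [Equiv.Perm.mul_apply, s_lo, s_hi] using h)
  rwa [mul_s_s] at this

theorem card_invSet_or (w : Equiv.Perm (Fin n)) (i : Fin (n - 1)) :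
    w (lo i) < w (hi i) ∨ w (hi i) < w (lo i) :=
  lt_or_gt_of_ne fun h => (lo_lt_hi i).ne (w.injective h)

theorem card_invSet_le (l : List (Fin (n - 1))) : (invSet (l.map s).prod).card ≤ l.length := by
  induction l using List.reverseRecOn with
  | nil =>
    simp only [List.map_nil, List.prod_nil, List.length_nil, Nat.le_zero, Finset.card_eq_zero]
    ext ⟨a, b⟩
    simp only [mem_invSet, Equiv.Perm.one_apply, Finset.notMem_empty, iff_false, not_and]
    exact fun h => not_lt_of_gt h
  | append_singleton l i ih =>
    simp only [List.map_append, List.map_cons, List.map_nil, List.prod_append, List.prod_cons,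
      List.prod_nil, mul_one, List.length_append, List.length_cons, List.length_nil]
    rcases card_invSet_or (l.map s).prod i with h | h
    · rw [card_invSet_asc h]; omega
    · have := card_invSet_desc h; omega

theorem eq_one_of_no_descent {w : Equiv.Perm (Fin n)} (h : ∀ i : Fin (n - 1), w (lo i) < w (hi i)) :
    w = 1 := by
  obtain _ | n := n
  · exact Subsingleton.elim _ _
  · have hm : StrictMono w := Fin.strictMono_iff_lt_succ.2 fun i => h i
    have : hm.orderIsoOfSurjective _ w.surjective = OrderIso.refl _ := Subsingleton.elim _ _
    ext x
    exact congrArg Fin.val (DFunLike.congr_fun this x)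

theorem exists_word (w : Equiv.Perm (Fin n)) :
    ∃ l : List (Fin (n - 1)), (l.map s).prod = w ∧ l.length = (invSet w).card := by
  induction hN : (invSet w).card generalizing w with
  | zero =>
    refine ⟨[], ?_, rfl⟩
    simp only [List.map_nil, List.prod_nil]
    refine (eq_one_of_no_descent fun i => ?_).symm
    rcases card_invSet_or w i with h | h
    · exact h
    · have := card_invSet_desc h; omega
  | succ N ih =>
    by_cases hd : ∀ i : Fin (n - 1), w (lo i) < w (hi i)
    · have h1 := eq_one_of_no_descent hd
      have h2 := card_invSet_le ([] : List (Fin (n - 1)))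
      simp only [List.map_nil, List.prod_nil, List.length_nil, ← h1] at h2
      omega
    · obtain ⟨i, hd⟩ := not_forall.1 hd
      have hi' := (card_invSet_or w i).resolve_left hd
      obtain ⟨l, hl, hl'⟩ := ih (w * s i) (by have := card_invSet_desc hi'; omega)
      exact ⟨l ++ [i], by simp [hl, mul_s_s], by simp [hl']⟩

theorem isReducedWord_iff {l : List (Fin (n - 1))} {w : Equiv.Perm (Fin n)} :
    IsReducedWord l w ↔ (l.map s).prod = w ∧ l.length = (invSet w).card := by
  constructor
  · rintro ⟨rfl, h⟩
    obtain ⟨l', h1, h2⟩ := exists_word (l.map s).prod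
    exact ⟨rfl, le_antisymm (h2 ▸ h l' h1) (card_invSet_le l)⟩
  · rintro ⟨rfl, h⟩
    refine ⟨rfl, fun l' h' => ?_⟩
    rw [h, ← h']
    exact card_invSet_le l'

theorem exists_isReducedWord (w : Equiv.Perm (Fin n)) :
    ∃ l : List (Fin (n - 1)), IsReducedWord l w := by
  obtain ⟨l, hl⟩ := exists_word w
  exact ⟨l, isReducedWord_iff.2 hl⟩

/-- If a family of elements of a monoid satisfies the braid relations of the symmetric group, its
product along a reduced word depends only on the permutation. -/
theorem word_property {M : Type*} [Monoid M] (p : Fin (n - 1) → M)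
    (h2 : ∀ i j : Fin (n - 1), i.1 + 1 = j.1 → p i * p j * p i = p j * p i * p j)
    (h3 : ∀ i j : Fin (n - 1), i.1 + 1 < j.1 → p i * p j = p j * p i)
    {l l' : List (Fin (n - 1))} {w : Equiv.Perm (Fin n)}
    (hl : IsReducedWord l w) (hl' : IsReducedWord l' w) :
    (l.map p).prod = (l'.map p).prod := by
  rw [isReducedWord_iff] at hl hl'
  induction hN : (invSet w).card using Nat.strong_induction_on generalizing w l l' with
  | _ N ih =>
    subst hN
    obtain ⟨hl, hc⟩ := hl
    obtain ⟨hl', hc'⟩ := hl'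
    rcases List.eq_nil_or_concat l with rfl | ⟨m, i, rfl⟩
    · have : l' = [] := List.length_eq_zero_iff.1 (by simp at hc; omega)
      rw [this]
    rcases List.eq_nil_or_concat l' with rfl | ⟨m', j, rfl⟩
    · simp at hc hc'; omega
    rw [List.concat_eq_append] at hl hc hl' hc' ⊢
    rw [List.concat_eq_append]
    simp only [List.map_append, List.map_cons, List.map_nil, List.prod_append, List.prod_cons,
      List.prod_nil, mul_one, List.length_append, List.length_cons, List.length_nil,
      Nat.zero_add] at hl hl' hc hc' ⊢
    have key : ∀ (m : List (Fin (n - 1))) (i : Fin (n - 1)), (m.map s).prod * s i = w →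
        m.length + 1 = (invSet w).card →
        w (hi i) < w (lo i) ∧ (m.map s).prod = w * s i ∧ m.length = (invSet (w * s i)).card := by
      intro m i hm hmc
      have e : (m.map s).prod = w * s i := by rw [← hm, mul_s_s]
      have hle := card_invSet_le m
      rw [e] at hle
      have hd : w (hi i) < w (lo i) := by
        rcases card_invSet_or w i with h | h
        · have := card_invSet_asc h; omega
        · exact h
      have := card_invSet_desc hd
      exact ⟨hd, e, by omega⟩
    obtain ⟨d1, e1, c1⟩ := key m i hl hc
    obtain ⟨d2, e2, c2⟩ := key m' j hl' hc'
    have main : ∀ (i j : Fin (n - 1)) (m m' : List (Fin (n - 1))), i < j →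
        w (hi i) < w (lo i) → (m.map s).prod = w * s i →
        m.length = (invSet (w * s i)).card → w (hi j) < w (lo j) →
        (m'.map s).prod = w * s j → m'.length = (invSet (w * s j)).card →
        (m.map p).prod * p i = (m'.map p).prod * p j := by
      intro i j m m' hij d1 e1 c1 d2 e2 c2
      have q1 := card_invSet_desc d1
      have q2 := card_invSet_desc d2
      rw [Fin.lt_def] at hij
      rcases Nat.lt_or_ge (i.1 + 1) j.1 with hc | hc
      · have f1 : s i (lo j) = lo j := s_fix (by simp only [lo]; omega) (by simp only [lo]; omega)
        have f2 : s i (hi j) = hi j := s_fix (by simp only [hi]; omega) (by simp only [hi]; omega)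
        have q3 := card_invSet_desc (w := w * s i) (i := j)
          (by simpa [Equiv.Perm.mul_apply, f1, f2] using d2)
        obtain ⟨v, hv, hv'⟩ := exists_word (w * s i * s j)
        have a1 := ih _ (by omega) (l := m) (l' := v ++ [j]) ⟨e1, c1⟩
          ⟨by simp [hv, mul_s_s], by simp [hv', q3]⟩ rfl
        have a2 := ih _ (by omega) (l := m') (l' := v ++ [i]) ⟨e2, c2⟩
          ⟨by
            simp only [List.map_append, List.prod_append, hv, List.map_cons, List.map_nil,
              List.prod_cons, List.prod_nil, mul_one]
            rw [mul_assoc w, s_comm hc, ← mul_assoc, mul_s_s],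
            by simp only [List.length_append, List.length_cons, List.length_nil, hv']; omega⟩ rfl
        rw [a1, a2]
        simp only [List.map_append, List.prod_append, List.map_cons, List.map_nil,
              List.prod_cons, List.prod_nil, mul_one]
        rw [mul_assoc, mul_assoc, h3 i j hc]
      · have hc : i.1 + 1 = j.1 := by omega
        have hm : hi i = lo j := by ext; simp [hi, lo, hc]
        have f1 : s i (lo j) = lo i := by rw [← hm, s_hi]
        have f2 : s i (hi j) = hi j := s_fix (by simp only [hi]; omega) (by simp only [hi]; omega)
        have f3 : s j (lo i) = lo i := s_fix (by simp only [lo]; omega) (by simp only [lo]; omega)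
        have f4 : s j (hi i) = hi j := by rw [hm, s_lo]
        have q3 := card_invSet_desc (w := w * s i) (i := j) (by
          simp only [Equiv.Perm.mul_apply, f1, f2]
          exact d2.trans (hm ▸ d1))
        have q4 := card_invSet_desc (w := w * s i * s j) (i := i) (by
          simp only [Equiv.Perm.mul_apply, f3, f4, f2, s_lo]
          rw [hm]
          exact d2)
        obtain ⟨v, hv, hv'⟩ := exists_word (w * s i * s j * s i)
        have a1 := ih _ (by omega) (l := m) (l' := v ++ [i, j]) ⟨e1, c1⟩
          ⟨by
            simp only [List.map_append, List.prod_append, hv, List.map_cons, List.map_nil,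
              List.prod_cons, List.prod_nil, mul_one]
            rw [← mul_assoc, mul_s_s, mul_s_s],
            by simp only [List.length_append, List.length_cons, List.length_nil, hv']; omega⟩ rfl
        have a2 := ih _ (by omega) (l := m') (l' := v ++ [j, i]) ⟨e2, c2⟩
          ⟨by
            simp only [List.map_append, List.prod_append, hv, List.map_cons, List.map_nil,
              List.prod_cons, List.prod_nil, mul_one]
            rw [mul_assoc w, mul_assoc w, s_braid hc, ← mul_assoc, ← mul_assoc, ← mul_assoc,
              mul_s_s, mul_s_s],
            by simp only [List.length_append, List.length_cons, List.length_nil, hv']; omega⟩ rfl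
        rw [a1, a2]
        simp only [List.map_append, List.prod_append, List.map_cons, List.map_nil,
              List.prod_cons, List.prod_nil, mul_one]
        simp only [mul_assoc]
        rw [← mul_assoc (p i), h2 i j hc, mul_assoc]
    rcases lt_trichotomy i j with hij | rfl | hij
    · exact main i j m m' hij d1 e1 c1 d2 e2 c2
    · rw [ih _ (by have := card_invSet_desc d1; omega) ⟨e1, c1⟩ ⟨e2, c2⟩ rfl]
    · exact (main j i m' m hij d2 e2 c2 d1 e1 c1).symm

/-- The element `π̄_w = π̄_{i_1} ⋯ π̄_{i_k}` of `H_n(0)`, for a reduced expression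
`w = s_{i_1} ⋯ s_{i_k}`. -/
noncomputable def piBar (F : Type*) [Field F] (w : Equiv.Perm (Fin n)) : ZeroHecke F n :=
  ((Classical.choose (exists_isReducedWord w)).map (genBar F)).prod

/-- `π̄_w` does not depend on the reduced expression. -/
theorem piBar_eq (F : Type*) [Field F] {w : Equiv.Perm (Fin n)} {l : List (Fin (n - 1))}
    (hl : IsReducedWord l w) : piBar F w = (l.map (genBar F)).prod :=
  word_property (genBar F) (fun _ _ h => genBar_braid F h) (fun _ _ h => genBar_comm F h)
    (Classical.choose_spec (exists_isReducedWord w)) hl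

end Words

/-! ### The polynomial representation -/

section Demazure

open MvPolynomial

variable (F : Type*) [Field F] {n : ℕ}

/-- The action of `s i` on polynomials by permutation of the variables. -/
noncomputable def sAct (i : Fin (n - 1)) :
    MvPolynomial (Fin n) F →ₐ[F] MvPolynomial (Fin n) F := rename (s i)

theorem demazure_dvd (i : Fin (n - 1)) (f : MvPolynomial (Fin n) F) :
    (X (lo i) - X (hi i) : MvPolynomial (Fin n) F) ∣ X (lo i) * f - X (hi i) * sAct F i f := by
  set I : Ideal (MvPolynomial (Fin n) F) := Ideal.span {X (lo i) - X (hi i)} with hI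
  have hX : Ideal.Quotient.mkₐ F I (X (lo i)) = Ideal.Quotient.mkₐ F I (X (hi i)) :=
    Ideal.Quotient.eq.2 (Ideal.mem_span_singleton_self _)
  have hs : (Ideal.Quotient.mkₐ F I).comp (sAct F i) = Ideal.Quotient.mkₐ F I := by
    apply MvPolynomial.algHom_ext
    intro x
    simp only [AlgHom.comp_apply, sAct, rename_X]
    rcases eq_or_ne x (lo i) with rfl | h1
    · rw [s_lo, hX]
    · rcases eq_or_ne x (hi i) with rfl | h2
      · rw [s_hi, hX]
      · rw [s, Equiv.swap_apply_of_ne_of_ne h1 h2]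
  rw [← Ideal.mem_span_singleton, ← hI]
  refine Ideal.Quotient.eq_zero_iff_mem.1 ?_
  change Ideal.Quotient.mkₐ F I _ = 0
  have := DFunLike.congr_fun hs f
  rw [AlgHom.comp_apply] at this
  rw [map_sub, map_mul, map_mul, this, hX, sub_self]

theorem X_lo_sub_ne (i : Fin (n - 1)) : (X (lo i) - X (hi i) : MvPolynomial (Fin n) F) ≠ 0 :=
  sub_ne_zero.2 fun h => (lo_lt_hi i).ne (X_injective h)

/-- The quotient `(x_i f - x_{i+1} s_i(f)) / (x_i - x_{i+1})`. -/
noncomputable def demazureFun (i : Fin (n - 1)) (f : MvPolynomial (Fin n) F) :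
    MvPolynomial (Fin n) F := Classical.choose (demazure_dvd F i f)

theorem demazureFun_spec (i : Fin (n - 1)) (f : MvPolynomial (Fin n) F) :
    (X (lo i) - X (hi i)) * demazureFun F i f = X (lo i) * f - X (hi i) * sAct F i f :=
  (Classical.choose_spec (demazure_dvd F i f)).symm

/-- The Demazure operator `π_i f = (x_i f - x_{i+1} s_i(f)) / (x_i - x_{i+1})`. -/
noncomputable def demazure (i : Fin (n - 1)) : Module.End F (MvPolynomial (Fin n) F) where
  toFun := demazureFun F i
  map_add' f g := by
    apply mul_left_cancel₀ (X_lo_sub_ne F i)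
    rw [mul_add, demazureFun_spec, demazureFun_spec, demazureFun_spec, map_add]
    ring
  map_smul' c f := by
    apply mul_left_cancel₀ (X_lo_sub_ne F i)
    rw [RingHom.id_apply, mul_smul_comm, demazureFun_spec, demazureFun_spec, map_smul,
      mul_smul_comm, mul_smul_comm, smul_sub]

theorem demazure_spec (i : Fin (n - 1)) (f : MvPolynomial (Fin n) F) :
    (X (lo i) - X (hi i)) * demazure F i f = X (lo i) * f - X (hi i) * sAct F i f :=
  demazureFun_spec F i f

theorem sAct_sAct (i : Fin (n - 1)) (f : MvPolynomial (Fin n) F) : sAct F i (sAct F i f) = f := by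
  have h : (s i : Fin n → Fin n) ∘ s i = id := funext (s_s i)
  simp only [sAct, rename_rename, h, rename_id, AlgHom.id_apply]

theorem sAct_demazure (i : Fin (n - 1)) (f : MvPolynomial (Fin n) F) :
    sAct F i (demazure F i f) = demazure F i f := by
  have h1 := demazure_spec F i f
  have h2 := congrArg (sAct F i) h1
  simp only [map_mul, map_sub, sAct_sAct] at h2
  have a1 : sAct F i (X (lo i)) = X (hi i) := by simp [sAct, s_lo]
  have a2 : sAct F i (X (hi i)) = X (lo i) := by simp [sAct, s_hi]
  rw [a1, a2] at h2
  apply mul_left_cancel₀ (X_lo_sub_ne F i)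
  linear_combination -h2 - h1

theorem demazure_of_sAct {i : Fin (n - 1)} {f : MvPolynomial (Fin n) F} (h : sAct F i f = f) :
    demazure F i f = f := by
  apply mul_left_cancel₀ (X_lo_sub_ne F i)
  rw [demazure_spec, h]
  ring

theorem demazure_idem (i : Fin (n - 1)) : demazure F i * demazure F i = demazure F i := by
  refine LinearMap.ext fun f => ?_
  rw [Module.End.mul_apply]
  exact demazure_of_sAct F (sAct_demazure F i f)

theorem demazure_comm (i j : Fin (n - 1)) (hij : i.1 + 1 < j.1) :
    demazure F i * demazure F j = demazure F j * demazure F i := by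
  refine LinearMap.ext fun f => ?_
  simp only [Module.End.mul_apply]
  have b1 : sAct F i (X (lo j)) = X (lo j) := by
    have : s i (lo j) = lo j := s_fix (by simp only [lo]; omega) (by simp only [lo]; omega)
    simp [sAct, this]
  have b2 : sAct F i (X (hi j)) = X (hi j) := by
    have : s i (hi j) = hi j := s_fix (by simp only [hi]; omega) (by simp only [hi]; omega)
    simp [sAct, this]
  have b3 : sAct F j (X (lo i)) = X (lo i) := by
    have : s j (lo i) = lo i := s_fix (by simp only [lo]; omega) (by simp only [lo]; omega)
    simp [sAct, this]
  have b4 : sAct F j (X (hi i)) = X (hi i) := by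
    have : s j (hi i) = hi i := s_fix (by simp only [hi]; omega) (by simp only [hi]; omega)
    simp [sAct, this]
  have hcomm : sAct F i (sAct F j f) = sAct F j (sAct F i f) := by
    have : (s i : Fin n → Fin n) ∘ s j = s j ∘ s i :=
      funext fun x => DFunLike.congr_fun (s_comm hij) x
    simp only [sAct, rename_rename, this]
  have g1 := demazure_spec F i f
  have g2 := demazure_spec F j f
  have g3 := demazure_spec F i (demazure F j f)
  have g4 := demazure_spec F j (demazure F i f)
  have g5 := congrArg (sAct F j) g1
  have g6 := congrArg (sAct F i) g2
  simp only [map_mul, map_sub, b1, b2, b3, b4] at g5 g6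
  rw [hcomm] at g6
  apply mul_left_cancel₀ (X_lo_sub_ne F i)
  apply mul_left_cancel₀ (X_lo_sub_ne F j)
  linear_combination (X (lo j) - X (hi j)) * g3 - (X (lo i) - X (hi i)) * g4
    + X (lo i) * g2 - X (hi i) * g6 - X (lo j) * g1 + X (hi j) * g5

theorem demazure_braid (i j : Fin (n - 1)) (hij : i.1 + 1 = j.1) :
    demazure F i * demazure F j * demazure F i = demazure F j * demazure F i * demazure F j := by
  refine LinearMap.ext fun f => ?_
  simp only [Module.End.mul_apply]
  have hm : hi i = lo j := by ext; simp [hi, lo, hij]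
  have b1 : sAct F i (X (lo i)) = X (lo j) := by simp [sAct, s_lo, hm]
  have b2 : sAct F i (X (lo j)) = X (lo i) := by simp [sAct, ← hm, s_hi]
  have b3 : sAct F i (X (hi j)) = X (hi j) := by
    have : s i (hi j) = hi j := s_fix (by simp only [hi]; omega) (by simp only [hi]; omega)
    simp [sAct, this]
  have b4 : sAct F j (X (lo i)) = X (lo i) := by
    have : s j (lo i) = lo i := s_fix (by simp only [lo]; omega) (by simp only [lo]; omega)
    simp [sAct, this]
  have b5 : sAct F j (X (lo j)) = X (hi j) := by simp [sAct, s_lo]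
  have b6 : sAct F j (X (hi j)) = X (lo j) := by simp [sAct, s_hi]
  have hbr : sAct F i (sAct F j (sAct F i f)) = sAct F j (sAct F i (sAct F j f)) := by
    have : (s i : Fin n → Fin n) ∘ s j ∘ s i = s j ∘ s i ∘ s j :=
      funext fun x => DFunLike.congr_fun (s_braid hij) x
    simp only [sAct, rename_rename, this]
  have hne : (X (lo i) - X (hi j) : MvPolynomial (Fin n) F) ≠ 0 :=
    sub_ne_zero.2 fun h => ((lo_lt_hi i).trans (hm ▸ lo_lt_hi j)).ne (X_injective h)
  have hn1 := X_lo_sub_ne F i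
  have hn2 := X_lo_sub_ne F j
  have p1 := demazure_spec F i f
  have p2 := demazure_spec F j (demazure F i f)
  have p3 := demazure_spec F i (demazure F j (demazure F i f))
  have p1' := congrArg (sAct F j) p1
  have p2' := congrArg (sAct F i) p2
  have p1'' := congrArg (sAct F i) p1'
  have r1 := demazure_spec F j f
  have r2 := demazure_spec F i (demazure F j f)
  have r3 := demazure_spec F j (demazure F i (demazure F j f))
  have r1' := congrArg (sAct F i) r1
  have r2' := congrArg (sAct F j) r2
  have r1'' := congrArg (sAct F j) r1'
  rw [hm] at *
  simp only [map_mul, map_sub, b1, b2, b3, b4, b5, b6, sAct_demazure] at p1' p2' p1'' r1' r2' r1''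
  rw [hbr] at p1''
  generalize demazure F i (demazure F j (demazure F i f)) = P3 at *
  generalize demazure F j (demazure F i (demazure F j f)) = R3 at *
  generalize sAct F i (demazure F j (demazure F i f)) = P2' at *
  generalize sAct F j (demazure F i (demazure F j f)) = R2' at *
  generalize sAct F i (sAct F j (demazure F i f)) = P1'' at *
  generalize sAct F j (sAct F i (demazure F j f)) = R1'' at *
  generalize demazure F j (demazure F i f) = P2 at *
  generalize demazure F i (demazure F j f) = R2 at *
  generalize sAct F j (demazure F i f) = P1' at *
  generalize sAct F i (demazure F j f) = R1' at *
  generalize demazure F i f = P1 at *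
  generalize demazure F j f = R1 at *
  generalize sAct F j (sAct F i (sAct F j f)) = f121 at *
  generalize sAct F i (sAct F j f) = f12 at *
  generalize sAct F j (sAct F i f) = f21 at *
  generalize sAct F i f = f1 at *
  generalize sAct F j f = f2 at *
  generalize (X (lo i) : MvPolynomial (Fin n) F) = a at *
  generalize (X (lo j) : MvPolynomial (Fin n) F) = b at *
  generalize (X (hi j) : MvPolynomial (Fin n) F) = c at *
  have L : (a - b) * (b - c) * (a - c) * P3 = a ^ 2 * b * f - a * b ^ 2 * f1 - a ^ 2 * c * f2
      + a * c ^ 2 * f21 + b ^ 2 * c * f12 - b * c ^ 2 * f121 := by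
    linear_combination (b - c) * (a - c) * p3 + a * (a - c) * p2 - b * (b - c) * p2' + a * b * p1
      - a * c * p1' + b * c * p1''
  have R : (a - b) * (b - c) * (a - c) * R3 = a ^ 2 * b * f - a * b ^ 2 * f1 - a ^ 2 * c * f2
      + a * c ^ 2 * f21 + b ^ 2 * c * f12 - b * c ^ 2 * f121 := by
    linear_combination (a - b) * (a - c) * r3 + b * (a - c) * r2 - c * (a - b) * r2' + a ^ 2 * r1
      - b ^ 2 * r1' + c ^ 2 * r1''
  exact mul_left_cancel₀ (mul_ne_zero (mul_ne_zero hn1 hn2) hne) (L.trans R.symm)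

/-- The representation of `H_n(0)` on `F[x_1, …, x_n]` in which `π_i` acts by the `i`-th Demazure
operator. -/
noncomputable def demazureRep (n : ℕ) :
    ZeroHecke F n →ₐ[F] Module.End F (MvPolynomial (Fin n) F) :=
  liftHecke F (demazure F) (demazure_idem F) (demazure_braid F) (demazure_comm F)

noncomputable instance : Module (ZeroHecke F n) (MvPolynomial (Fin n) F) :=
  Module.compHom _ (demazureRep F n).toRingHom

theorem gen_smul_poly (i : Fin (n - 1)) (f : MvPolynomial (Fin n) F) :
    gen F i • f = demazure F i f := by
  change demazureRep F n (gen F i) f = _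
  rw [demazureRep, liftHecke_gen]

instance : IsScalarTower F (ZeroHecke F n) (MvPolynomial (Fin n) F) where
  smul_assoc c h f := by
    change demazureRep F n (c • h) f = c • demazureRep F n h f
    rw [map_smul, LinearMap.smul_apply]

/-- The monomial `x_α = ∏_{i ∈ D(α)} x_1 ⋯ x_i`. -/
noncomputable def xComp (α : Composition n) : MvPolynomial (Fin n) F :=
  open Classical in
  ∏ i ∈ Finset.univ.filter (· ∈ compDescents α),
    ∏ j ∈ Finset.univ.filter (fun j : Fin n => j.1 ≤ i.1), X j

end Demazure

/-! ### Modules of standard tableaux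

A diagram is a set of cells `(r, c)`: the row index `r` increases from bottom to top, the column
index `c` increases from left to right. -/

/-- A standard tableau with entries `Fin n`: a bijective filling of the diagram `D`, increasing
from left to right in rows and from top to bottom in columns. -/
structure StdTableau (D : Set (ℕ × ℕ)) (n : ℕ) where
  /-- The filling. -/
  entry : D ≃ Fin n
  row_lt : ∀ x y : D, x.1.1 = y.1.1 → x.1.2 < y.1.2 → entry x < entry y
  col_lt : ∀ x y : D, x.1.2 = y.1.2 → y.1.1 < x.1.1 → entry x < entry y

section Tableaux

variable {D : Set (ℕ × ℕ)} {n : ℕ}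

/-- The row of the entry `a` in a filling. -/
def rowOf (e : D ≃ Fin n) (a : Fin n) : ℕ := (e.symm a).1.1

/-- The tableau `s_i(τ)` obtained by exchanging the entries `i` and `i + 1`, when `i` is in a lower
row than `i + 1`. -/
def StdTableau.swap (τ : StdTableau D n) (i : Fin (n - 1))
    (h : rowOf τ.entry (lo i) < rowOf τ.entry (hi i)) : StdTableau D n where
  entry := τ.entry.trans (s i)
  row_lt x y h1 h2 := by
    refine s_lt (τ.row_lt x y h1 h2) ?_
    rintro ⟨h3, h4⟩
    rw [← h3, ← h4] at h
    simp only [rowOf, Equiv.symm_apply_apply] at h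
    omega
  col_lt x y h1 h2 := by
    refine s_lt (τ.col_lt x y h1 h2) ?_
    rintro ⟨h3, h4⟩
    rw [← h3, ← h4] at h
    simp only [rowOf, Equiv.symm_apply_apply] at h
    omega

variable (F : Type*) [Field F]

/-- The vector space with basis the standard tableaux of shape `D`. -/
def TabModule (D : Set (ℕ × ℕ)) (n : ℕ) := StdTableau D n →₀ F

noncomputable instance : AddCommGroup (TabModule F D n) :=
  inferInstanceAs (AddCommGroup (StdTableau D n →₀ F))

noncomputable instance : Module F (TabModule F D n) :=
  inferInstanceAs (Module F (StdTableau D n →₀ F))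

/-- The basis vector of `TabModule` given by a standard tableau. -/
noncomputable def tab (τ : StdTableau D n) : TabModule F D n := Finsupp.single τ (1 : F)

/-- The action of `π̄_i` on a standard tableau `τ`: it is `-τ` if `i` is in a higher row of `τ` than
`i + 1`, `0` if `i` is in the same row as `i + 1`, and `s_i(τ)` if `i` is in a lower row than
`i + 1`. -/
noncomputable def tabBarFun (i : Fin (n - 1)) (τ : StdTableau D n) : TabModule F D n :=
  if h : rowOf τ.entry (lo i) < rowOf τ.entry (hi i) then tab F (τ.swap i h)
  else if rowOf τ.entry (lo i) = rowOf τ.entry (hi i) then 0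
  else -tab F τ

/-- The linear operator by which `π̄_i` acts. -/
noncomputable def tabBar (i : Fin (n - 1)) : Module.End F (TabModule F D n) :=
  Finsupp.linearCombination F (tabBarFun F i)

theorem tabBar_tab (i : Fin (n - 1)) (τ : StdTableau D n) :
    tabBar F i (tab F τ) = tabBarFun F i τ := by
  unfold tabBar tab
  erw [Finsupp.linearCombination_single]
  rw [one_smul]

/-- The same operator on all bijective fillings. -/
noncomputable def fillBar (i : Fin (n - 1)) : Module.End F ((D ≃ Fin n) →₀ F) :=
  Finsupp.linearCombination F fun e =>
    if rowOf e (lo i) < rowOf e (hi i) then Finsupp.single (e.trans (s i)) 1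
    else if rowOf e (lo i) = rowOf e (hi i) then 0
    else -Finsupp.single e 1

/-- The inclusion of standard tableaux in bijective fillings. -/
noncomputable def tabIncl : TabModule F D n →ₗ[F] ((D ≃ Fin n) →₀ F) :=
  Finsupp.lmapDomain F F StdTableau.entry

theorem tabIncl_tab (τ : StdTableau D n) : tabIncl F (tab F τ) = Finsupp.single τ.entry 1 :=
  Finsupp.mapDomain_single

theorem tabIncl_injective : Function.Injective (tabIncl F : TabModule F D n →ₗ[F] _) := by
  apply Finsupp.mapDomain_injective
  rintro ⟨e, _, _⟩ ⟨e', _, _⟩ h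
  simpa using h

theorem tab_ext {V : Type*} [AddCommGroup V] [Module F V] {f g : TabModule F D n →ₗ[F] V}
    (h : ∀ τ, f (tab F τ) = g (tab F τ)) : f = g :=
  Finsupp.lhom_ext' fun τ => LinearMap.ext_ring (h τ)

theorem tabIncl_tabBar (i : Fin (n - 1)) (v : TabModule F D n) :
    tabIncl F (tabBar F i v) = fillBar F i (tabIncl F v) := by
  have : (tabIncl F).comp (tabBar F i) = (fillBar F i).comp (tabIncl F (D := D)) := by
    apply tab_ext
    intro τ
    simp only [LinearMap.comp_apply, tabBar_tab, tabIncl_tab, fillBar,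
      Finsupp.linearCombination_single, one_smul, tabBarFun]
    split_ifs
    · rw [tabIncl_tab]; rfl
    · rw [map_zero]
    · rw [map_neg, tabIncl_tab]
  exact LinearMap.congr_fun this v

theorem fillBar_single (i : Fin (n - 1)) (e : D ≃ Fin n) :
    fillBar F i (Finsupp.single e 1) =
      if rowOf e (lo i) < rowOf e (hi i) then Finsupp.single (e.trans (s i)) 1
      else if rowOf e (lo i) = rowOf e (hi i) then 0
      else -Finsupp.single e 1 := by
  simp only [fillBar, Finsupp.linearCombination_single, one_smul]

theorem rowOf_trans (i : Fin (n - 1)) (e : D ≃ Fin n) (a : Fin n) :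
    rowOf (e.trans (s i)) a = rowOf e (s i a) := by
  have : (s i).symm a = s i a := (Equiv.symm_apply_eq _).2 (s_s i a).symm
  simp [rowOf, this]

theorem trans_s_s (i : Fin (n - 1)) (e : D ≃ Fin n) : (e.trans (s i)).trans (s i) = e := by
  ext x; simp [s_s]

theorem row_trichotomy (a b : ℕ) :
    (a < b ∧ ¬ b < a ∧ a ≠ b ∧ b ≠ a) ∨ a = b ∨ (b < a ∧ ¬ a < b ∧ a ≠ b ∧ b ≠ a) := by
  omega

theorem fillBar_sq (i : Fin (n - 1)) :
    fillBar F i * fillBar F i = -(fillBar F i : Module.End F ((D ≃ Fin n) →₀ F)) := by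
  refine Finsupp.lhom_ext' fun e => LinearMap.ext_ring ?_
  simp only [LinearMap.comp_apply, Finsupp.lsingle_apply, Module.End.mul_apply,
    LinearMap.neg_apply, fillBar_single]
  rcases lt_trichotomy (rowOf e (lo i)) (rowOf e (hi i)) with h | h | h
  · simp [h, fillBar_single, rowOf_trans, s_lo, s_hi, h.not_gt, h.ne']
  · simp [h]
  · simp [h.not_gt, h.ne', fillBar_single]

theorem fillBar_comm {i j : Fin (n - 1)} (hij : i.1 + 1 < j.1) :
    fillBar F i * fillBar F j =
      (fillBar F j * fillBar F i : Module.End F ((D ≃ Fin n) →₀ F)) := by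
  refine Finsupp.lhom_ext' fun e => LinearMap.ext_ring ?_
  have f1 : s i (lo j) = lo j := s_fix (by simp only [lo]; omega) (by simp only [lo]; omega)
  have f2 : s i (hi j) = hi j := s_fix (by simp only [hi]; omega) (by simp only [hi]; omega)
  have f3 : s j (lo i) = lo i := s_fix (by simp only [lo]; omega) (by simp only [lo]; omega)
  have f4 : s j (hi i) = hi i := s_fix (by simp only [hi]; omega) (by simp only [hi]; omega)
  have hc : (e.trans (s i)).trans (s j) = (e.trans (s j)).trans (s i) := by
    ext x
    exact congrArg Fin.val (DFunLike.congr_fun (s_comm hij) (e x)).symm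
  simp only [LinearMap.comp_apply, Finsupp.lsingle_apply, Module.End.mul_apply, fillBar_single]
  rcases row_trichotomy (rowOf e (lo i)) (rowOf e (hi i)) with h | h | h <;>
  rcases row_trichotomy (rowOf e (lo j)) (rowOf e (hi j)) with h' | h' | h' <;>
  simp [h, h', fillBar_single, rowOf_trans, f1, f2, f3, f4, hc]

theorem fillBar_braid {i j : Fin (n - 1)} (hij : i.1 + 1 = j.1) :
    fillBar F i * fillBar F j * fillBar F i =
      (fillBar F j * fillBar F i * fillBar F j : Module.End F ((D ≃ Fin n) →₀ F)) := by
  refine Finsupp.lhom_ext' fun e => LinearMap.ext_ring ?_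
  have hm : hi i = lo j := by ext; simp [hi, lo, hij]
  have f1 : s i (lo i) = lo j := by rw [s_lo, hm]
  have f2 : s i (lo j) = lo i := by rw [← hm, s_hi]
  have f3 : s i (hi j) = hi j := s_fix (by simp only [hi]; omega) (by simp only [hi]; omega)
  have f4 : s j (lo i) = lo i := s_fix (by simp only [lo]; omega) (by simp only [lo]; omega)
  have f5 : s j (lo j) = hi j := s_lo j
  have f6 : s j (hi j) = lo j := s_hi j
  have hc : ((e.trans (s i)).trans (s j)).trans (s i) =
      ((e.trans (s j)).trans (s i)).trans (s j) := by
    ext x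
    exact congrArg Fin.val (DFunLike.congr_fun (s_braid hij) (e x))
  simp only [LinearMap.comp_apply, Finsupp.lsingle_apply, Module.End.mul_apply, fillBar_single]
  have k1 := rowOf_trans (D := D) i
  have k2 := rowOf_trans (D := D) j
  rcases row_trichotomy (rowOf e (lo i)) (rowOf e (lo j)) with h | h | h <;>
  rcases row_trichotomy (rowOf e (lo j)) (rowOf e (hi j)) with h' | h' | h' <;>
  rcases row_trichotomy (rowOf e (lo i)) (rowOf e (hi j)) with h'' | h'' | h'' <;>
  first
  | (exfalso; omega)
  | simp [h, h', h'', fillBar_single, k1, k2, hm, f1, f2, f3, f4, f5, f6, hc]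

theorem tabBar_sq (i : Fin (n - 1)) :
    tabBar F i * tabBar F i = -(tabBar F i : Module.End F (TabModule F D n)) := by
  refine LinearMap.ext fun v => tabIncl_injective F ?_
  simpa [tabIncl_tabBar] using LinearMap.congr_fun (fillBar_sq F i) (tabIncl F v)

theorem tabBar_comm {i j : Fin (n - 1)} (hij : i.1 + 1 < j.1) :
    tabBar F i * tabBar F j = (tabBar F j * tabBar F i : Module.End F (TabModule F D n)) := by
  refine LinearMap.ext fun v => tabIncl_injective F ?_
  simpa [tabIncl_tabBar] using LinearMap.congr_fun (fillBar_comm F hij) (tabIncl F v)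

theorem tabBar_braid {i j : Fin (n - 1)} (hij : i.1 + 1 = j.1) :
    tabBar F i * tabBar F j * tabBar F i =
      (tabBar F j * tabBar F i * tabBar F j : Module.End F (TabModule F D n)) := by
  refine LinearMap.ext fun v => tabIncl_injective F ?_
  simpa [tabIncl_tabBar] using LinearMap.congr_fun (fillBar_braid F hij) (tabIncl F v)

/-- The representation of `H_n(0)` on `TabModule`, in which `π_i = π̄_i + 1`. -/
noncomputable def tabRep (D : Set (ℕ × ℕ)) (n : ℕ) :
    ZeroHecke F n →ₐ[F] Module.End F (TabModule F D n) :=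
  liftHecke F (fun i => tabBar F i + 1)
    (by
      intro i
      have e : (tabBar F i + 1) * (tabBar F i + 1) =
          (tabBar F i * tabBar F i + tabBar F i + tabBar F i + 1 :
            Module.End F (TabModule F D n)) := by noncomm_ring
      rw [e, tabBar_sq]
      abel)
    (by
      intro i j hij
      have e : ∀ a b : Module.End F (TabModule F D n), (a + 1) * (b + 1) * (a + 1) =
          a * b * a + a * b + b * a + a * a + a + a + b + 1 := by intro a b; noncomm_ring
      rw [e, e, tabBar_sq, tabBar_sq, tabBar_braid F hij]
      abel)
    (by
      intro i j hij
      have e : ∀ a b : Module.End F (TabModule F D n), (a + 1) * (b + 1) =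
          a * b + a + b + 1 := by intro a b; noncomm_ring
      rw [e, e, tabBar_comm F hij]
      abel)

noncomputable instance : Module (ZeroHecke F n) (TabModule F D n) :=
  Module.compHom _ (tabRep F D n).toRingHom

theorem genBar_smul_tab (i : Fin (n - 1)) (τ : StdTableau D n) :
    genBar F i • tab F τ = tabBarFun F i τ := by
  change tabRep F D n (genBar F i) (tab F τ) = _
  rw [genBar, map_sub, map_one, tabRep, liftHecke_gen, add_sub_cancel_right, tabBar_tab]

instance : IsScalarTower F (ZeroHecke F n) (TabModule F D n) where
  smul_assoc c h f := by
    change tabRep F D n (c • h) f = c • tabRep F D n h f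
    rw [map_smul, LinearMap.smul_apply]

end Tableaux

/-- The diagram `α_1 ⊕ ⋯ ⊕ α_ℓ`: its connected components are single rows of lengths
`α_1, …, α_ℓ`, from bottom to top, each one strictly to the northeast of the preceding one. -/
def rowsDiagram {n : ℕ} (α : Composition n) : Set (ℕ × ℕ) :=
  {x | x.1 < α.length ∧ α.sizeUpTo x.1 ≤ x.2 ∧ x.2 < α.sizeUpTo (x.1 + 1)}

/-- The `H_n(0)`-module `M_α` of standard tableaux of shape `α_1 ⊕ ⋯ ⊕ α_ℓ`. -/
abbrev MModule (F : Type*) [Field F] {n : ℕ} (α : Composition n) :=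
  TabModule F (rowsDiagram α) n

end HeckePoly

namespace HeckePoly

/-! ### Generalities on the 0-Hecke algebra and its basis `π̄_w` -/

section Hecke

variable {F : Type*} [Field F] {n : ℕ}

/-! Both modules are cyclic: `M_α` is generated by the base tableau `τ₀`, and the other module by
`x_α`. So it suffices to show that `x_α` and `τ₀` have the same annihilator in `H_n(0)`
(`smul_eq_zero_iff`). The elements `π̄_w` span `H_n(0)`, and a descent `i` of `w` lets `π̄_i` be
split off on the right. If `i ∉ D(α)`, then `π̄_i` kills both generators, so on either of them only
the `π̄_w` with `D(w) ⊆ D(α)` matter (`sum_piBar_smul`). For these, `π̄_w τ₀` is the tableau `w τ₀`;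
every tableau arises exactly once (`piBar_smul_baseTableau`). Hence, if `h = ∑ c_w π̄_w` kills `τ₀`,
then `c_w = 0` whenever `D(w) ⊆ D(α)`, and `h` kills `x_α`. For the converse, filter polynomials by
the sum of squares of the exponents. Modulo smaller terms, `π̄_i` sends `x^μ` to `x^{s_i μ}`, `0` or
`-x^μ` according as `μ_i` is greater than, equal to or less than `μ_{i+1}`. This is the tableau rule
if each entry gets the exponent `ℓ - 1 - row`, and `τ₀` then corresponds to `x_α`. Thus `h x_α` is
the image of `h τ₀` up to smaller terms (`smul_sub_tabMonomial_mem`). Distinct tableaux have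
distinct monomials on the same level, so `h x_α = 0` forces `h τ₀ = 0`. -/

theorem ZeroHecke.induction {p : ZeroHecke F n → Prop}
    (scalar : ∀ c : F, p (algebraMap F (ZeroHecke F n) c)) (genBar : ∀ i, p (genBar F i))
    (mul : ∀ a b, p a → p b → p (a * b)) (add : ∀ a b, p a → p b → p (a + b))
    (h : ZeroHecke F n) : p h := by
  obtain ⟨x, rfl⟩ := RingQuot.mkAlgHom_surjective F (HeckeRel F n) h
  induction x using FreeAlgebra.induction with
  | grade0 c =>
    rw [AlgHom.commutes]
    exact scalar c
  | grade1 i =>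
    have e : (RingQuot.mkAlgHom F (HeckeRel F n) (FreeAlgebra.ι F i) : ZeroHecke F n) =
        HeckePoly.genBar F i + algebraMap F (ZeroHecke F n) 1 := by
      rw [map_one]; exact (sub_add_cancel (gen F i) 1).symm
    exact e ▸ add _ _ (genBar i) (scalar 1)
  | mul a b ha hb => rw [map_mul]; exact mul _ _ ha hb
  | add a b ha hb => rw [map_add]; exact add _ _ ha hb

theorem genBar_sq (i : Fin (n - 1)) : genBar F i * genBar F i = -genBar F i := by
  have e : genBar F i * genBar F i = gen F i * gen F i - gen F i - gen F i + 1 := by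
    unfold genBar; noncomm_ring
  rw [e, gen_idem, genBar]
  abel

theorem piBar_one : piBar F (1 : Equiv.Perm (Fin n)) = 1 := by
  have h : IsReducedWord ([] : List (Fin (n - 1))) 1 := ⟨by simp, fun _ _ => Nat.zero_le _⟩
  simpa using piBar_eq F h

/-- Going up at `i` adds exactly one inversion, so a reduced word of `w` followed by `i` is again
reduced. -/
theorem piBar_mul_s {w : Equiv.Perm (Fin n)} {i : Fin (n - 1)} (h : w (lo i) < w (hi i)) :
    piBar F (w * s i) = piBar F w * genBar F i := by
  obtain ⟨l, hl⟩ := exists_isReducedWord w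
  have hl' := isReducedWord_iff.1 hl
  have h2 : IsReducedWord (l ++ [i]) (w * s i) :=
    isReducedWord_iff.2 ⟨by simp [hl'.1], by simp [hl'.2, card_invSet_asc h]⟩
  rw [piBar_eq F hl, piBar_eq F h2]
  simp

theorem piBar_of_descent {w : Equiv.Perm (Fin n)} {i : Fin (n - 1)} (h : w (hi i) < w (lo i)) :
    piBar F w = piBar F (w * s i) * genBar F i := by
  have h' : (w * s i) (lo i) < (w * s i) (hi i) := by
    simpa [Equiv.Perm.mul_apply, s_lo, s_hi] using h
  rw [← piBar_mul_s h', mul_s_s]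

theorem piBar_mul_genBar_of_descent {w : Equiv.Perm (Fin n)} {i : Fin (n - 1)}
    (h : w (hi i) < w (lo i)) : piBar F w * genBar F i = -piBar F w := by
  rw [piBar_of_descent h, mul_assoc, genBar_sq, mul_neg]

/-- The elements `π̄_w` span the 0-Hecke algebra. -/
theorem mem_span_piBar (h : ZeroHecke F n) :
    h ∈ Submodule.span F (Set.range (piBar F : Equiv.Perm (Fin n) → ZeroHecke F n)) := by
  -- The span is a right ideal, by induction on the multiplier `h`; it contains `π̄_1 = 1`, hence
  -- everything.
  have key : ∀ h : ZeroHecke F n,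
      ∀ x ∈ Submodule.span F (Set.range (piBar F : Equiv.Perm (Fin n) → ZeroHecke F n)),
      x * h ∈ Submodule.span F (Set.range (piBar F)) := by
    intro h
    induction h using ZeroHecke.induction with
    | scalar c =>
      intro x hx
      rw [← Algebra.commutes, ← Algebra.smul_def]
      exact Submodule.smul_mem _ _ hx
    | genBar i =>
      intro x hx
      induction hx using Submodule.span_induction with
      | mem x hx =>
        obtain ⟨w, rfl⟩ := hx
        rcases card_invSet_or w i with hw | hw
        · rw [← piBar_mul_s hw]
          exact Submodule.subset_span ⟨_, rfl⟩
        · rw [piBar_mul_genBar_of_descent hw]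
          exact Submodule.neg_mem _ (Submodule.subset_span ⟨_, rfl⟩)
      | zero => rw [zero_mul]; exact Submodule.zero_mem _
      | add x y _ _ hx hy => rw [add_mul]; exact Submodule.add_mem _ hx hy
      | smul c x _ hx => rw [smul_mul_assoc]; exact Submodule.smul_mem _ _ hx
    | mul a b ha hb => intro x hx; rw [← mul_assoc]; exact hb _ (ha _ hx)
    | add a b ha hb => intro x hx; rw [mul_add]; exact Submodule.add_mem _ (ha _ hx) (hb _ hx)
  have := key h _ (Submodule.subset_span ⟨1, rfl⟩)
  rwa [piBar_one, one_mul] at this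

theorem exists_sum_piBar (h : ZeroHecke F n) :
    ∃ c : Equiv.Perm (Fin n) → F, ∑ w, c w • piBar F w = h :=
  (Submodule.mem_span_range_iff_exists_fun F).1 (mem_span_piBar h)

/-- The factor `π̄_i` of a descent acts first. This discards every `w` with `D(w) ⊄ D(α)`. -/
theorem piBar_smul_eq_zero {V : Type*} [AddCommGroup V] [Module (ZeroHecke F n) V] {v : V}
    {w : Equiv.Perm (Fin n)} {i : Fin (n - 1)} (hi : i ∈ permDescents w)
    (hv : genBar F i • v = 0) : piBar F w • v = 0 := by
  rw [piBar_of_descent hi, mul_smul, hv, smul_zero]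

/-! ### Inverses and multiplication by generators on the left -/

theorem isReducedWord_reverse {l : List (Fin (n - 1))} {w : Equiv.Perm (Fin n)}
    (h : IsReducedWord l w) : IsReducedWord l.reverse w⁻¹ := by
  have rev : ∀ l : List (Fin (n - 1)),
      (l.reverse.map s).prod = ((l.map s).prod : Equiv.Perm (Fin n))⁻¹ := by
    intro l
    induction l with
    | nil => simp
    | cons i l ih =>
      rw [List.reverse_cons, List.map_append, List.prod_append, ih, List.map_cons, List.map_nil,
        List.prod_singleton, List.map_cons, List.prod_cons, mul_inv_rev,
        inv_eq_of_mul_eq_one_left (s_mul_self i)]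
  refine ⟨by rw [rev, h.1], fun l' hl' => ?_⟩
  have := h.2 l'.reverse (by rw [rev, hl', inv_inv])
  simpa using this

theorem card_invSet_inv (w : Equiv.Perm (Fin n)) : (invSet w⁻¹).card = (invSet w).card := by
  obtain ⟨l, hl⟩ := exists_isReducedWord w
  rw [← (isReducedWord_iff.1 hl).2, ← (isReducedWord_iff.1 (isReducedWord_reverse hl)).2,
    List.length_reverse]

theorem s_inv (i : Fin (n - 1)) : (s i : Equiv.Perm (Fin n))⁻¹ = s i :=
  inv_eq_of_mul_eq_one_left (s_mul_self i)

theorem card_invSet_s_mul {w : Equiv.Perm (Fin n)} {i : Fin (n - 1)}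
    (h : w⁻¹ (lo i) < w⁻¹ (hi i)) : (invSet (s i * w)).card = (invSet w).card + 1 := by
  rw [← card_invSet_inv, mul_inv_rev, s_inv, card_invSet_asc h, card_invSet_inv]

theorem piBar_s_mul {w : Equiv.Perm (Fin n)} {i : Fin (n - 1)} (h : w⁻¹ (lo i) < w⁻¹ (hi i)) :
    piBar F (s i * w) = genBar F i * piBar F w := by
  obtain ⟨l, hl⟩ := exists_isReducedWord w
  have hl' := isReducedWord_iff.1 hl
  have h2 : IsReducedWord (i :: l) (s i * w) :=
    isReducedWord_iff.2 ⟨by simp [hl'.1], by simp [hl'.2, card_invSet_s_mul h]⟩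
  rw [piBar_eq F hl, piBar_eq F h2]
  simp

/-- Exchanging the values `i` and `i + 1` could only destroy a descent at which these two values are
adjacent in decreasing order, and the hypothesis puts `i` before `i + 1`. So the condition `D(w) ⊆
D(α)` survives when a left factor is stripped. -/
theorem permDescents_subset_s_mul {w : Equiv.Perm (Fin n)} {i : Fin (n - 1)}
    (h : w⁻¹ (lo i) < w⁻¹ (hi i)) : permDescents w ⊆ permDescents (s i * w) := by
  intro j hj
  refine s_lt hj ?_
  rintro ⟨h1, h2⟩
  rw [← h1, ← h2, Equiv.Perm.inv_def, Equiv.symm_apply_apply, Equiv.symm_apply_apply] at h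
  exact absurd h (not_lt_of_gt (lo_lt_hi j))

end Hecke

/-! ### The base tableau -/

section Base

variable {n : ℕ} (α : Composition n)

/-! ### Blocks of a composition -/

theorem eq_index_iff {a : Fin n} {k : ℕ} :
    (α.index a).1 = k ↔ α.sizeUpTo k ≤ a.1 ∧ a.1 < α.sizeUpTo (k + 1) := by
  have h1 := α.sizeUpTo_index_le a
  have h2 := α.lt_sizeUpTo_index_succ a
  rw [Fin.val_succ] at h2
  constructor
  · rintro rfl
    exact ⟨h1, h2⟩
  · rintro ⟨h3, h4⟩
    rcases lt_trichotomy (α.index a).1 k with h | h | h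
    · have := α.monotone_sizeUpTo (show (α.index a).1 + 1 ≤ k from h)
      omega
    · exact h
    · have := α.monotone_sizeUpTo (show k + 1 ≤ (α.index a).1 from h)
      omega

theorem lt_sizeUpTo_iff {a : Fin n} {k : ℕ} : a.1 < α.sizeUpTo k ↔ (α.index a).1 < k := by
  obtain ⟨h1, h2⟩ := (eq_index_iff α (a := a)).1 rfl
  constructor
  · intro h
    by_contra hk
    have := α.monotone_sizeUpTo (not_lt.1 hk)
    omega
  · intro h
    exact h2.trans_le (α.monotone_sizeUpTo h)

theorem index_mono {a b : Fin n} (h : a ≤ b) : (α.index a).1 ≤ (α.index b).1 := by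
  by_contra hlt
  have h1 := (lt_sizeUpTo_iff α).2 (not_le.1 hlt)
  obtain ⟨h2, -⟩ := (eq_index_iff α (a := a)).1 rfl
  rw [Fin.le_def] at h
  omega

theorem mem_compDescents_iff {i : Fin (n - 1)} :
    i ∈ compDescents α ↔ (α.index (lo i)).1 ≠ (α.index (hi i)).1 := by
  have hl : (lo i : Fin n).1 = i.1 := rfl
  have hh : (hi i : Fin n).1 = i.1 + 1 := rfl
  constructor
  · rintro ⟨k, -, -, hk⟩ he
    have h1 : (α.index (lo i)).1 < k := (lt_sizeUpTo_iff α).1 (by omega)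
    rw [he, ← lt_sizeUpTo_iff α] at h1
    omega
  · intro h
    have hlt := lt_of_le_of_ne (index_mono α (lo_lt_hi i).le) h
    -- The boundary is the start of the block of the second position: the first position lies before
    -- it and the second does not.
    refine ⟨(α.index (hi i)).1, by omega, (α.index (hi i)).2, ?_⟩
    have h1 := (lt_sizeUpTo_iff α).2 hlt
    have h2 := ((eq_index_iff α (a := hi i)).1 rfl).1
    omega

/-- The tableau of shape `α_1 ⊕ ⋯ ⊕ α_ℓ` with entries in order from bottom to top. -/
def baseTableau : StdTableau (rowsDiagram α) n where
  entry :=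
    -- The columns of the diagram are `0, …, n - 1`, each used once, so the column itself serves as
    -- the entry.
    { toFun := fun x => ⟨x.1.2, x.2.2.2.trans_le (α.sizeUpTo_le _)⟩
      invFun := fun a => ⟨((α.index a).1, a.1), (α.index a).2, (eq_index_iff α).1 rfl⟩
      left_inv := by
        rintro ⟨⟨r, c⟩, h1, h2, h3⟩
        exact Subtype.ext (Prod.ext ((eq_index_iff α (a := ⟨c, h3.trans_le (α.sizeUpTo_le _)⟩)).2
          ⟨h2, h3⟩) rfl)
      right_inv := fun a => rfl }
  row_lt x y _ h := h
  col_lt x y h1 h2 := by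
    obtain ⟨⟨r, c⟩, hx1, hx2, hx3⟩ := x
    obtain ⟨⟨r', c'⟩, hy1, hy2, hy3⟩ := y
    -- Different rows occupy disjoint intervals of columns, so the column condition is vacuous.
    have h3 := α.monotone_sizeUpTo (show r' + 1 ≤ r from h2)
    have h4 : c = c' := h1
    have h5 : c' < α.sizeUpTo (r' + 1) := hy3
    have h6 : α.sizeUpTo r ≤ c := hx2
    omega

theorem rowOf_baseTableau (a : Fin n) : rowOf (baseTableau α).entry a = (α.index a).1 := rfl

theorem rowOf_baseTableau_trans (w : Equiv.Perm (Fin n)) (a : Fin n) :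
    rowOf ((baseTableau α).entry.trans w) a = (α.index (w⁻¹ a)).1 := rfl

/-- If the descents of `w` are contained in `D(α)`, then `w` increases along rows. -/
theorem lt_of_index_eq {w : Equiv.Perm (Fin n)} (hw : permDescents w ⊆ compDescents α)
    {a b : Fin n} (hab : a < b) (h : (α.index a).1 = (α.index b).1) : w a < w b := by
  obtain ⟨a, ha⟩ := a
  obtain ⟨b, hb⟩ := b
  rw [Fin.mk_lt_mk] at hab
  induction b, hab using Nat.le_induction with
  | base =>
    refine (card_invSet_or w ⟨a, by omega⟩).resolve_right fun hd => ?_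
    exact (mem_compDescents_iff α).1 (hw (show _ ∈ permDescents w from hd)) h
  | succ b hab ih =>
    -- The position `b` lies between `a` and `b + 1`, so monotonicity forces it into their common
    -- block.
    have h1 := index_mono α (a := ⟨a, ha⟩) (b := ⟨b, by omega⟩) (by rw [Fin.mk_le_mk]; omega)
    have h2 := index_mono α (a := ⟨b, by omega⟩) (b := ⟨b + 1, hb⟩) (by rw [Fin.mk_le_mk]; omega)
    refine (ih (by omega) (by omega)).trans
      ((card_invSet_or w ⟨b, by omega⟩).resolve_right fun hd => ?_)
    refine (mem_compDescents_iff α).1 (hw (show _ ∈ permDescents w from hd)) ?_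
    change (α.index ⟨b, _⟩).1 = (α.index ⟨b + 1, _⟩).1
    omega

/-- Take for `w` the reading of `τ` in the order of the base tableau; a descent inside a block would
violate the increase along a row. -/
theorem exists_perm_of_tableau (τ : StdTableau (rowsDiagram α) n) :
    ∃ w : Equiv.Perm (Fin n), permDescents w ⊆ compDescents α ∧
      (baseTableau α).entry.trans w = τ.entry := by
  refine ⟨(baseTableau α).entry.symm.trans τ.entry, fun i hi' => ?_, by
    ext x; simp⟩
  rw [mem_compDescents_iff]
  intro h
  exact absurd (τ.row_lt ((baseTableau α).entry.symm (lo i)) ((baseTableau α).entry.symm (hi i)) h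
    (lo_lt_hi i)) (not_lt_of_gt hi')

theorem stdTableau_ext {D : Set (ℕ × ℕ)} {τ τ' : StdTableau D n} (h : τ.entry = τ'.entry) :
    τ = τ' := by
  cases τ; cases τ'; simpa using h

/-- A standard tableau is determined by the rows of its entries. -/
theorem stdTableau_ext_rowOf {D : Set (ℕ × ℕ)} {τ τ' : StdTableau D n}
    (h : ∀ a, rowOf τ.entry a = rowOf τ'.entry a) : τ = τ' := by
  apply stdTableau_ext
  -- Along a row the filling is strictly increasing, hence determined by its range, which is the set
  -- of entries lying in that row.
  have key : ∀ r : ℕ, (fun c : {c : ℕ // (r, c) ∈ D} => τ.entry ⟨(r, c.1), c.2⟩) =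
      fun c : {c : ℕ // (r, c) ∈ D} => τ'.entry ⟨(r, c.1), c.2⟩ := by
    intro r
    have hr : ∀ σ : StdTableau D n,
        Set.range (fun c : {c : ℕ // (r, c) ∈ D} => σ.entry ⟨(r, c.1), c.2⟩) =
          {a | rowOf σ.entry a = r} := by
      intro σ
      ext a
      constructor
      · rintro ⟨c, rfl⟩
        simp [rowOf]
      · intro ha
        have hx := (σ.entry.symm a).2
        refine ⟨⟨(σ.entry.symm a).1.2, ?_⟩, ?_⟩
        · rw [← show rowOf σ.entry a = r from ha]
          exact hx
        · rw [← Equiv.eq_symm_apply]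
          exact Subtype.ext (Prod.ext (show rowOf σ.entry a = r from ha).symm rfl)
    have hm : ∀ σ : StdTableau D n,
        StrictMono fun c : {c : ℕ // (r, c) ∈ D} => σ.entry ⟨(r, c.1), c.2⟩ :=
      fun σ c d hcd => σ.row_lt _ _ rfl hcd
    refine ((hm τ).range_inj (hm τ')).1 ?_
    rw [hr, hr]
    simp only [h]
  ext ⟨⟨r, c⟩, hx⟩
  exact congrArg Fin.val (congrFun (key r) ⟨c, hx⟩)

/-! ### The tableau module is generated by the base tableau -/

variable (F : Type*) [Field F]

/-- The basis `tab τ` of the module of standard tableaux. -/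
noncomputable def tabBasis (D : Set (ℕ × ℕ)) (n : ℕ) :
    Module.Basis (StdTableau D n) F (TabModule F D n) := ⟨LinearEquiv.refl F _⟩

theorem tabBasis_apply {D : Set (ℕ × ℕ)} (τ : StdTableau D n) : tabBasis F D n τ = tab F τ := rfl

theorem genBar_smul_baseTableau {i : Fin (n - 1)} (h : i ∉ compDescents α) :
    genBar F i • tab F (baseTableau α) = 0 := by
  rw [mem_compDescents_iff, not_not] at h
  rw [genBar_smul_tab, tabBarFun, dif_neg (by simp only [rowOf_baseTableau]; omega),
    if_pos (by simpa only [rowOf_baseTableau] using h)]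

/-- Induction on the length, with `w = s_i v` and `v` shorter: in the tableau `v τ₀` the entry `i`
is in a lower row than `i + 1`, so `π̄_i` acts by the exchange. -/
theorem piBar_smul_baseTableau {w : Equiv.Perm (Fin n)} (hw : permDescents w ⊆ compDescents α) :
    ∃ τ : StdTableau (rowsDiagram α) n, τ.entry = (baseTableau α).entry.trans w ∧
      piBar F w • tab F (baseTableau α) = tab F τ := by
  induction hN : (invSet w).card generalizing w with
  | zero =>
    have h1 : w = 1 := eq_one_of_no_descent fun i =>
      (card_invSet_or w i).resolve_right fun h => by have := card_invSet_desc h; omega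
    subst h1
    exact ⟨baseTableau α, rfl, by rw [piBar_one, one_smul]⟩
  | succ N ih =>
    by_cases hd : ∀ i : Fin (n - 1), w⁻¹ (lo i) < w⁻¹ (hi i)
    · have h1 := eq_one_of_no_descent hd
      have h2 := card_invSet_le ([] : List (Fin (n - 1)))
      simp only [List.map_nil, List.prod_nil, List.length_nil, ← h1, card_invSet_inv] at h2
      omega
    · obtain ⟨i, hd⟩ := not_forall.1 hd
      have hd := (card_invSet_or w⁻¹ i).resolve_left hd
      obtain ⟨v, rfl⟩ : ∃ v, w = s i * v :=
        ⟨s i * w, by rw [← mul_assoc, s_mul_self, one_mul]⟩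
      have hv : v⁻¹ (lo i) < v⁻¹ (hi i) := by
        simpa [mul_inv_rev, s_inv, Equiv.Perm.mul_apply, s_lo, s_hi] using hd
      have hvs := (permDescents_subset_s_mul hv).trans hw
      have hc := card_invSet_s_mul hv
      obtain ⟨τ, h1, h2⟩ := ih hvs (by omega)
      have hrow : rowOf τ.entry (lo i) < rowOf τ.entry (hi i) := by
        rw [h1, rowOf_baseTableau_trans, rowOf_baseTableau_trans]
        -- Position order gives `≤` for the rows. If the rows were equal, `w = s_i v` would decrease
        -- within a block, contrary to `D(w) ⊆ D(α)`.
        refine lt_of_le_of_ne (index_mono α hv.le) fun he => ?_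
        have := lt_of_index_eq α hw hv he
        simp only [Equiv.Perm.mul_apply, Equiv.Perm.inv_def, Equiv.apply_symm_apply, s_lo,
          s_hi] at this
        exact absurd this (not_lt_of_gt (lo_lt_hi i))
      refine ⟨τ.swap i hrow, ?_, ?_⟩
      · change τ.entry.trans (s i) = _
        rw [h1]
        rfl
      · rw [piBar_s_mul hv, mul_smul, h2, genBar_smul_tab, tabBarFun, dif_pos hrow]

/-- The tableau `w τ₀`, where `τ₀` is the base tableau. -/
noncomputable def permTableau
    (w : {w : Equiv.Perm (Fin n) // permDescents w ⊆ compDescents α}) :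
    StdTableau (rowsDiagram α) n :=
  Classical.choose (piBar_smul_baseTableau α F w.2)

theorem permTableau_entry (w : {w : Equiv.Perm (Fin n) // permDescents w ⊆ compDescents α}) :
    (permTableau α F w).entry = (baseTableau α).entry.trans w.1 :=
  (Classical.choose_spec (piBar_smul_baseTableau α F w.2)).1

theorem piBar_smul_eq_permTableau
    (w : {w : Equiv.Perm (Fin n) // permDescents w ⊆ compDescents α}) :
    piBar F w.1 • tab F (baseTableau α) = tab F (permTableau α F w) := by
  obtain ⟨τ, h1, h2⟩ := piBar_smul_baseTableau α F w.2
  rw [h2, stdTableau_ext (h1.trans (permTableau_entry α F w).symm)]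

theorem permTableau_injective : Function.Injective (permTableau α F) := by
  intro v w h
  have h' := permTableau_entry α F v
  rw [h, permTableau_entry] at h'
  refine Subtype.ext (Equiv.ext fun a => ?_)
  have := DFunLike.congr_fun h' ((baseTableau α).entry.symm a)
  simpa using this.symm

theorem permTableau_surjective : Function.Surjective (permTableau α F) := by
  intro τ
  obtain ⟨w, hw, he⟩ := exists_perm_of_tableau α τ
  exact ⟨⟨w, hw⟩, stdTableau_ext ((permTableau_entry α F ⟨w, hw⟩).trans he)⟩

theorem linearIndependent_piBar_smul_baseTableau :
    LinearIndependent F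
      fun w : {w : Equiv.Perm (Fin n) // permDescents w ⊆ compDescents α} =>
        piBar F w.1 • tab F (baseTableau α) := by
  simp only [piBar_smul_eq_permTableau]
  exact (tabBasis F (rowsDiagram α) n).linearIndependent.comp _ (permTableau_injective α F)

theorem span_baseTableau :
    Submodule.span (ZeroHecke F n) {tab F (baseTableau α)} = ⊤ := by
  rw [eq_top_iff]
  intro v _
  have hv : v ∈ Submodule.span F (Set.range (tabBasis F (rowsDiagram α) n)) := by
    rw [Module.Basis.span_eq]; trivial
  induction hv using Submodule.span_induction with
  | mem x hx =>
    obtain ⟨τ, rfl⟩ := hx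
    obtain ⟨w, rfl⟩ := permTableau_surjective α F τ
    rw [tabBasis_apply, ← piBar_smul_eq_permTableau]
    exact Submodule.smul_mem _ _ (Submodule.mem_span_singleton_self _)
  | zero => exact Submodule.zero_mem _
  | add x y _ _ hx hy => exact Submodule.add_mem _ (hx trivial) (hy trivial)
  | smul c x _ hx => exact Submodule.smul_of_tower_mem _ c (hx trivial)

end Base

/-! ### Leading monomials of the Demazure operators -/

section Leading

open MvPolynomial

variable {F : Type*} [Field F] {n : ℕ}

/-- The sum of the squares of the exponents. -/
def sqSum (μ : Fin n →₀ ℕ) : ℕ := ∑ a, μ a ^ 2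

theorem sqSum_add_single (μ : Fin n →₀ ℕ) (a : Fin n) (p : ℕ) :
    sqSum (μ + Finsupp.single a p) = sqSum μ + 2 * μ a * p + p ^ 2 := by
  have h : ∀ x, (μ x + Finsupp.single a p x) ^ 2 =
      μ x ^ 2 + (if x = a then 2 * μ a * p + p ^ 2 else 0) := by
    intro x
    rw [Finsupp.single_apply]
    split_ifs with h1 h2 h2
    · subst h1; ring
    · exact absurd h1.symm h2
    · exact absurd h2.symm h1
    · ring
  simp only [sqSum, Finsupp.add_apply, h, Finset.sum_add_distrib, Finset.sum_ite_eq',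
    Finset.mem_univ, if_true]
  ring

theorem sqSum_mapDomain (w : Equiv.Perm (Fin n)) (μ : Fin n →₀ ℕ) :
    sqSum (μ.mapDomain w) = sqSum μ := by
  unfold sqSum
  rw [← Equiv.sum_comp w]
  simp only [Finsupp.mapDomain_apply w.injective]

theorem sAct_monomial (i : Fin (n - 1)) (μ : Fin n →₀ ℕ) (c : F) :
    sAct F i (monomial μ c) = monomial (μ.mapDomain (s i)) c := rename_monomial _ _ _

/-- So `π̄_i` is the divided difference followed by multiplication by `x_{i+1}`. -/
theorem genBar_smul_spec (i : Fin (n - 1)) (f : MvPolynomial (Fin n) F) :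
    (X (lo i) - X (hi i)) * (genBar F i • f) = X (hi i) * (f - sAct F i f) := by
  rw [genBar, sub_smul, one_smul, gen_smul_poly, mul_sub, demazure_spec]
  ring

theorem genBar_smul_of_sAct {i : Fin (n - 1)} {f : MvPolynomial (Fin n) F} (h : sAct F i f = f) :
    genBar F i • f = 0 := by
  rw [genBar, sub_smul, one_smul, gen_smul_poly, demazure_of_sAct F h, sub_self]

theorem mapDomain_s_of_eq {i : Fin (n - 1)} {ν : Fin n →₀ ℕ} (h : ν (lo i) = ν (hi i)) :
    ν.mapDomain (s i) = ν := by
  ext x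
  have e : ν.mapDomain (s i) x = ν (s i x) := by
    conv_lhs => rw [← s_s i x]
    exact Finsupp.mapDomain_apply (s i).injective _ _
  rw [e]
  rcases eq_or_ne x (lo i) with rfl | h1
  · rw [s_lo, h]
  · rcases eq_or_ne x (hi i) with rfl | h2
    · rw [s_hi, h]
    · rw [s, Equiv.swap_apply_of_ne_of_ne h1 h2]

/-! ### The action of `π̄_i` on monomials -/

theorem monomial_lo_sub_hi (i : Fin (n - 1)) (ν : Fin n →₀ ℕ) (d : ℕ) :
    (X (lo i) - X (hi i)) * ∑ k ∈ Finset.range d,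
      monomial (ν + Finsupp.single (lo i) k + Finsupp.single (hi i) (d - k)) (1 : F) =
      X (hi i) * (monomial (ν + Finsupp.single (lo i) d) 1 -
        monomial (ν + Finsupp.single (hi i) d) 1) := by
  have e : ∀ (ν : Fin n →₀ ℕ) (a : Fin n) (k : ℕ),
      monomial (ν + Finsupp.single a k) (1 : F) = monomial ν 1 * X a ^ k := by
    intro ν a k
    rw [X_pow_eq_monomial, monomial_mul, one_mul]
  have e2 : ∑ k ∈ Finset.range d,
      monomial (ν + Finsupp.single (lo i) k + Finsupp.single (hi i) (d - k)) (1 : F) =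
      monomial ν 1 * X (hi i) * ∑ k ∈ Finset.range d, X (lo i) ^ k * X (hi i) ^ (d - 1 - k) := by
    rw [Finset.mul_sum]
    refine Finset.sum_congr rfl fun k hk => ?_
    -- The extra factor `x_{i+1}` of `π̄_i` raises the second exponent of the geometric sum by one.
    have hk' : d - k = d - 1 - k + 1 := by have := Finset.mem_range.1 hk; omega
    rw [e, e, hk', pow_succ]
    ring
  rw [e2, e, e]
  have g := (Commute.all (X (lo i) : MvPolynomial (Fin n) F) (X (hi i))).geom_sum₂_mul d
  linear_combination (monomial ν 1 * X (hi i)) * g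

/-- The factor `x^ν` is invariant under `s_i`, so `f - s_i f` is `x^ν (x_i^d - x_{i+1}^d)`, which
the geometric sum divides out. -/
theorem genBar_smul_lo {i : Fin (n - 1)} {ν : Fin n →₀ ℕ} (h : ν (lo i) = ν (hi i)) (d : ℕ) :
    genBar F i • monomial (ν + Finsupp.single (lo i) d) (1 : F) = ∑ k ∈ Finset.range d,
      monomial (ν + Finsupp.single (lo i) k + Finsupp.single (hi i) (d - k)) (1 : F) := by
  apply mul_left_cancel₀ (X_lo_sub_ne F i)
  rw [genBar_smul_spec, monomial_lo_sub_hi, sAct_monomial, Finsupp.mapDomain_add,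
    mapDomain_s_of_eq h, Finsupp.mapDomain_single, s_lo]

theorem genBar_smul_hi {i : Fin (n - 1)} {ν : Fin n →₀ ℕ} (h : ν (lo i) = ν (hi i)) (d : ℕ) :
    genBar F i • monomial (ν + Finsupp.single (hi i) d) (1 : F) = -∑ k ∈ Finset.range d,
      monomial (ν + Finsupp.single (lo i) k + Finsupp.single (hi i) (d - k)) (1 : F) := by
  apply mul_left_cancel₀ (X_lo_sub_ne F i)
  rw [mul_neg, genBar_smul_spec, monomial_lo_sub_hi, sAct_monomial, Finsupp.mapDomain_add,
    mapDomain_s_of_eq h, Finsupp.mapDomain_single, s_hi]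
  ring

/-- The span of the monomials whose exponents have sum of squares less than `N`. -/
noncomputable def lowerSpan (F : Type*) [Field F] (n N : ℕ) : Submodule F (MvPolynomial (Fin n) F) :=
  Submodule.span F {f | ∃ μ, sqSum μ < N ∧ f = monomial μ 1}

theorem monomial_mem_lowerSpan {N : ℕ} {μ : Fin n →₀ ℕ} (h : sqSum μ < N) :
    monomial μ (1 : F) ∈ lowerSpan F n N := Submodule.subset_span ⟨μ, h, rfl⟩

theorem coeff_eq_zero_of_mem_lowerSpan {N : ℕ} {f : MvPolynomial (Fin n) F}
    (hf : f ∈ lowerSpan F n N) {μ : Fin n →₀ ℕ} (hμ : N ≤ sqSum μ) : coeff μ f = 0 := by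
  induction hf using Submodule.span_induction with
  | mem f hf =>
    obtain ⟨ν, hν, rfl⟩ := hf
    rw [coeff_monomial, if_neg]
    rintro rfl
    omega
  | zero => rw [coeff_zero]
  | add f g _ _ hf hg => rw [coeff_add, hf, hg, add_zero]
  | smul c f _ hf => rw [coeff_smul, hf, smul_zero]

/-- Only the term `k = 0` leaves the whole excess `d` on one variable; the others share it, which
strictly lowers the sum of squares. -/
theorem sum_sub_mem_lowerSpan {i : Fin (n - 1)} {ν : Fin n →₀ ℕ} (h : ν (lo i) = ν (hi i))
    {d : ℕ} (hd : 0 < d) :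
    ∑ k ∈ Finset.range d,
      monomial (ν + Finsupp.single (lo i) k + Finsupp.single (hi i) (d - k)) (1 : F) -
      monomial (ν + Finsupp.single (hi i) d) 1 ∈
        lowerSpan F n (sqSum (ν + Finsupp.single (hi i) d)) := by
  obtain ⟨d, rfl⟩ := Nat.exists_eq_succ_of_ne_zero hd.ne'
  rw [Finset.sum_range_succ', Finsupp.single_zero, add_zero, Nat.sub_zero, add_sub_cancel_right]
  refine Submodule.sum_mem _ fun k hk => monomial_mem_lowerSpan ?_
  obtain ⟨m, hm⟩ := Nat.exists_eq_add_of_lt (Finset.mem_range.1 hk)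
  -- The two shares are `k + 1` and `m + 1`, both positive; the sum of squares drops by twice their
  -- product.
  have e : d.succ - (k + 1) = m + 1 := by omega
  rw [sqSum_add_single, sqSum_add_single, sqSum_add_single, e, Finsupp.add_apply,
    Finsupp.single_eq_of_ne (lo_lt_hi i).ne', add_zero, h, hm]
  nlinarith

/-- Splits an exponent into a part with equal entries at `a` and `b` and the excess at `b`, the form
that `genBar_smul_lo` and `genBar_smul_hi` require. -/
theorem exists_eq_add_single {μ : Fin n →₀ ℕ} {a b : Fin n} (hab : a ≠ b) (h : μ a ≤ μ b) :
    ∃ (ν : Fin n →₀ ℕ) (d : ℕ), ν a = ν b ∧ μ = ν + Finsupp.single b d ∧ d = μ b - μ a := by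
  refine ⟨μ - Finsupp.single b (μ b - μ a), μ b - μ a, ?_, ?_, rfl⟩
  · rw [Finsupp.tsub_apply, Finsupp.tsub_apply, Finsupp.single_eq_same,
      Finsupp.single_eq_of_ne hab]
    omega
  · refine (tsub_add_cancel_of_le ?_).symm
    rw [Finsupp.single_le_iff]
    omega

theorem genBar_smul_monomial_gt {i : Fin (n - 1)} {μ : Fin n →₀ ℕ} (h : μ (hi i) < μ (lo i)) :
    genBar F i • monomial μ (1 : F) - monomial (μ.mapDomain (s i)) 1 ∈
      lowerSpan F n (sqSum μ) := by
  -- The bound is rewritten for the exchanged exponent, which is the term `k = 0` of the sum.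
  rw [← sqSum_mapDomain (s i)]
  obtain ⟨ν, d, h1, h2, h3⟩ := exists_eq_add_single (lo_lt_hi i).ne' h.le
  have e : μ.mapDomain (s i) = ν + Finsupp.single (hi i) d := by
    rw [h2, Finsupp.mapDomain_add, mapDomain_s_of_eq h1.symm, Finsupp.mapDomain_single, s_lo]
  rw [e, h2, genBar_smul_lo h1.symm]
  exact sum_sub_mem_lowerSpan h1.symm (by omega)

theorem genBar_smul_monomial_lt {i : Fin (n - 1)} {μ : Fin n →₀ ℕ} (h : μ (lo i) < μ (hi i)) :
    genBar F i • monomial μ (1 : F) - -monomial μ 1 ∈ lowerSpan F n (sqSum μ) := by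
  obtain ⟨ν, d, h1, h2, h3⟩ := exists_eq_add_single (lo_lt_hi i).ne h.le
  rw [h2, genBar_smul_hi h1, ← neg_sub', Submodule.neg_mem_iff]
  exact sum_sub_mem_lowerSpan h1 (by omega)

theorem genBar_smul_monomial_eq {i : Fin (n - 1)} {μ : Fin n →₀ ℕ} (h : μ (lo i) = μ (hi i)) :
    genBar F i • monomial μ (1 : F) = 0 :=
  genBar_smul_of_sAct (by rw [sAct_monomial, mapDomain_s_of_eq h])

theorem lowerSpan_mono {M N : ℕ} (h : M ≤ N) : lowerSpan F n M ≤ lowerSpan F n N :=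
  Submodule.span_mono fun _ ⟨μ, hμ, e⟩ => ⟨μ, hμ.trans_le h, e⟩

theorem smul_comm_hecke {V : Type*} [AddCommGroup V] [Module F V] [Module (ZeroHecke F n) V]
    [IsScalarTower F (ZeroHecke F n) V] (c : F) (h : ZeroHecke F n) (v : V) :
    h • c • v = c • h • v := by
  rw [← algebraMap_smul (ZeroHecke F n) c v, ← algebraMap_smul (ZeroHecke F n) c (h • v),
    smul_smul, smul_smul, Algebra.commutes]

/-- On a monomial the leading term, if any, is the monomial or its exchange up to sign, with the
same sum of squares, and the rest is smaller. -/
theorem genBar_smul_mem_lowerSpan {N : ℕ} (i : Fin (n - 1)) {f : MvPolynomial (Fin n) F}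
    (hf : f ∈ lowerSpan F n N) : genBar F i • f ∈ lowerSpan F n N := by
  induction hf using Submodule.span_induction with
  | mem f hf =>
    obtain ⟨μ, hμ, rfl⟩ := hf
    have hle : lowerSpan F n (sqSum μ) ≤ lowerSpan F n N := lowerSpan_mono hμ.le
    rcases lt_trichotomy (μ (lo i)) (μ (hi i)) with h | h | h
    · exact (Submodule.sub_mem_iff_left _ (Submodule.neg_mem _ (monomial_mem_lowerSpan hμ))).1
        (hle (genBar_smul_monomial_lt h))
    · rw [genBar_smul_monomial_eq h]; exact Submodule.zero_mem _
    · exact (Submodule.sub_mem_iff_left _ (monomial_mem_lowerSpan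
        (by rwa [sqSum_mapDomain]))).1 (hle (genBar_smul_monomial_gt h))
  | zero => rw [smul_zero]; exact Submodule.zero_mem _
  | add f g _ _ hf hg => rw [smul_add]; exact Submodule.add_mem _ hf hg
  | smul c f _ hf => rw [smul_comm_hecke]; exact Submodule.smul_mem _ _ hf

end Leading

/-! ### Comparison of the polynomial module with the module of tableaux -/

section Comparison

open MvPolynomial

variable {n : ℕ} (α : Composition n)

/-- The exponent attached to a tableau: entries in lower rows have larger exponents. -/
noncomputable def tabExp (τ : StdTableau (rowsDiagram α) n) : Fin n →₀ ℕ :=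
  Finsupp.equivFunOnFinite.symm fun a => α.length - 1 - rowOf τ.entry a

theorem tabExp_apply (τ : StdTableau (rowsDiagram α) n) (a : Fin n) :
    tabExp α τ a = α.length - 1 - rowOf τ.entry a := rfl

/-- Guarantees that the truncated subtraction in `tabExp` loses nothing. -/
theorem rowOf_lt (τ : StdTableau (rowsDiagram α) n) (a : Fin n) :
    rowOf τ.entry a < α.length := (τ.entry.symm a).2.1

theorem tabExp_injective : Function.Injective (tabExp α) := by
  intro τ τ' h
  refine stdTableau_ext_rowOf fun a => ?_
  have h1 := DFunLike.congr_fun h a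
  rw [tabExp_apply, tabExp_apply] at h1
  have h2 := rowOf_lt α τ a
  have h3 := rowOf_lt α τ' a
  omega

theorem tabExp_swap (τ : StdTableau (rowsDiagram α) n) (i : Fin (n - 1))
    (h : rowOf τ.entry (lo i) < rowOf τ.entry (hi i)) :
    tabExp α (τ.swap i h) = (tabExp α τ).mapDomain (s i) := by
  ext a
  have e : (tabExp α τ).mapDomain (s i) a = tabExp α τ (s i a) := by
    conv_lhs => rw [← s_s i a]
    exact Finsupp.mapDomain_apply (s i).injective _ _
  rw [e, tabExp_apply, tabExp_apply, ← rowOf_trans]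
  rfl

/-- Any two fillings differ by a permutation of the entries. Hence one `lowerSpan` lies below the
monomials of all tableaux. -/
theorem sqSum_tabExp (τ : StdTableau (rowsDiagram α) n) :
    sqSum (tabExp α τ) = sqSum (tabExp α (baseTableau α)) := by
  have e : tabExp α τ =
      (tabExp α (baseTableau α)).mapDomain ((baseTableau α).entry.symm.trans τ.entry) := by
    ext a
    obtain ⟨b, rfl⟩ := ((baseTableau α).entry.symm.trans τ.entry).surjective a
    rw [Finsupp.mapDomain_apply (Equiv.injective _), tabExp_apply, tabExp_apply]
    simp [rowOf]
  rw [e, sqSum_mapDomain]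

variable (F : Type*) [Field F]

/-- The linear map that sends a tableau to its monomial. -/
noncomputable def tabMonomial : MModule F α →ₗ[F] MvPolynomial (Fin n) F :=
  (tabBasis F (rowsDiagram α) n).constr F fun τ => monomial (tabExp α τ) 1

theorem tabMonomial_tab (τ : StdTableau (rowsDiagram α) n) :
    tabMonomial α F (tab F τ) = monomial (tabExp α τ) 1 := by
  rw [tabMonomial, ← tabBasis_apply, Module.Basis.constr_basis]

/-- Distinct tableaux have distinct exponents, so coordinates can be read off as coefficients. -/
theorem coeff_tabMonomial (v : MModule F α) (τ : StdTableau (rowsDiagram α) n) :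
    coeff (tabExp α τ) (tabMonomial α F v) = (tabBasis F (rowsDiagram α) n).repr v τ := by
  classical
  have h : (lcoeff F (tabExp α τ)).comp (tabMonomial α F) =
      (tabBasis F (rowsDiagram α) n).coord τ := by
    refine (tabBasis F (rowsDiagram α) n).ext fun σ => ?_
    rw [LinearMap.comp_apply, tabBasis_apply, tabMonomial_tab, ← tabBasis_apply,
      Module.Basis.coord_apply, Module.Basis.repr_self, lcoeff_apply, coeff_monomial,
      Finsupp.single_apply]
    simp only [(tabExp_injective α).eq_iff]
  exact LinearMap.congr_fun h v

/-- The span of the monomials that are smaller than those of tableaux. -/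
noncomputable abbrev lowerComp : Submodule F (MvPolynomial (Fin n) F) :=
  lowerSpan F n (sqSum (tabExp α (baseTableau α)))

theorem eq_zero_of_tabMonomial_mem {v : MModule F α} (h : tabMonomial α F v ∈ lowerComp α F) :
    v = 0 := by
  apply (tabBasis F (rowsDiagram α) n).repr.injective
  ext τ
  rw [← coeff_tabMonomial, coeff_eq_zero_of_mem_lowerSpan h (sqSum_tabExp α τ).ge, map_zero,
    Finsupp.zero_apply]

/-- Exponents reverse the order of rows, so the three cases of the tableau rule match the three
leading terms on monomials. -/
theorem genBar_smul_tabMonomial (i : Fin (n - 1)) (v : MModule F α) :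
    genBar F i • tabMonomial α F v - tabMonomial α F (genBar F i • v) ∈ lowerComp α F := by
  have hv : v ∈ Submodule.span F (Set.range (tabBasis F (rowsDiagram α) n)) := by
    rw [Module.Basis.span_eq]; trivial
  induction hv using Submodule.span_induction with
  | mem x hx =>
    obtain ⟨τ, rfl⟩ := hx
    rw [tabBasis_apply, genBar_smul_tab, tabMonomial_tab, lowerComp, ← sqSum_tabExp α τ, tabBarFun]
    have h1 := rowOf_lt α τ (lo i)
    have h2 := rowOf_lt α τ (hi i)
    split_ifs with h h'
    · rw [tabMonomial_tab, tabExp_swap]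
      exact genBar_smul_monomial_gt (by simp only [tabExp_apply]; omega)
    · rw [genBar_smul_monomial_eq (by simp only [tabExp_apply]; omega), map_zero, sub_zero]
      exact Submodule.zero_mem _
    · rw [map_neg, tabMonomial_tab]
      exact genBar_smul_monomial_lt (by simp only [tabExp_apply]; omega)
  | zero => simp
  | add x y _ _ hx hy =>
    rw [map_add, smul_add, smul_add, map_add, add_sub_add_comm]
    exact Submodule.add_mem _ hx hy
  | smul c x _ hx =>
    rw [map_smul, smul_comm_hecke, smul_comm_hecke, map_smul, ← smul_sub]
    exact Submodule.smul_mem _ _ hx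

theorem smul_sub_tabMonomial_mem (h : ZeroHecke F n) {f : MvPolynomial (Fin n) F}
    {v : MModule F α} (hf : f - tabMonomial α F v ∈ lowerComp α F) :
    h • f - tabMonomial α F (h • v) ∈ lowerComp α F := by
  -- For a product, the hypothesis for `a` is applied to `b • f` and `b • v`, so both vectors must
  -- vary.
  induction h using ZeroHecke.induction generalizing f v with
  | scalar c =>
    rw [algebraMap_smul, algebraMap_smul, map_smul, ← smul_sub]
    exact Submodule.smul_mem _ _ hf
  | genBar i =>
    have := Submodule.add_mem _ (genBar_smul_mem_lowerSpan i hf) (genBar_smul_tabMonomial α F i v)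
    rwa [smul_sub, sub_add_sub_cancel] at this
  | mul a b ha hb => rw [mul_smul, mul_smul]; exact ha (hb hf)
  | add a b ha hb =>
    rw [add_smul, add_smul, map_add, add_sub_add_comm]
    exact Submodule.add_mem _ (ha hf) (hb hf)

/-! ### The monomial `x_α` and its annihilator -/

open Classical in
theorem card_compDescents_ge (j : Fin n) :
    (Finset.univ.filter fun i : Fin (n - 1) => i ∈ compDescents α ∧ j.1 ≤ i.1).card =
      α.length - 1 - (α.index j).1 := by
  have hc : (Finset.Ioo (α.index j).1 α.length).card = α.length - 1 - (α.index j).1 := by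
    rw [Nat.card_Ioo]; omega
  rw [← hc]
  have hpos : ∀ k ∈ Finset.Ioo (α.index j).1 α.length, j.1 < α.sizeUpTo k ∧ α.sizeUpTo k < n := by
    intro k hk
    rw [Finset.mem_Ioo] at hk
    exact ⟨(lt_sizeUpTo_iff α).2 hk.1, (α.sizeUpTo_strict_mono hk.2).trans_le (α.sizeUpTo_le _)⟩
  -- Elements of `D(α)` beyond `j` are the partial sums indexed by the `k` between the block of `j`
  -- and `ℓ`. The `- 1` is there because the index `i` stands for the element `i + 1`.
  refine (Finset.card_bij
    (fun k hk => (⟨α.sizeUpTo k - 1, by have := hpos k hk; omega⟩ : Fin (n - 1))) ?_ ?_ ?_).symm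
  · intro k hk
    have := hpos k hk
    rw [Finset.mem_Ioo] at hk
    rw [Finset.mem_filter]
    exact ⟨Finset.mem_univ _, ⟨k, by omega, hk.2, by simp only; omega⟩, by simp only; omega⟩
  · intro k hk k' hk' he
    have h1 := hpos k hk
    have h2 := hpos k' hk'
    rw [Finset.mem_Ioo] at hk hk'
    have he' : α.sizeUpTo k = α.sizeUpTo k' := by
      have := congrArg Fin.val he
      simp only at this
      omega
    rcases lt_trichotomy k k' with h | h | h
    · have h3 := α.monotone_sizeUpTo (show k + 1 ≤ k' from h)
      have h4 := α.sizeUpTo_strict_mono hk.2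
      omega
    · exact h
    · have h3 := α.monotone_sizeUpTo (show k' + 1 ≤ k from h)
      have h4 := α.sizeUpTo_strict_mono hk'.2
      omega
  · intro i hi'
    rw [Finset.mem_filter] at hi'
    obtain ⟨-, ⟨k, -, hk2, hk3⟩, hji⟩ := hi'
    exact ⟨k, Finset.mem_Ioo.2 ⟨(lt_sizeUpTo_iff α).1 (by omega), hk2⟩, by ext; simp [hk3]⟩

theorem xComp_eq_monomial : xComp F α = monomial (tabExp α (baseTableau α)) 1 := by
  classical
  have e : xComp F α = ∏ j : Fin n, X j ^ (tabExp α (baseTableau α) j) := by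
    unfold xComp
    -- Interchanging the products makes the exponent of `x_j` the number of elements of `D(α)` not
    -- before `j`.
    rw [Finset.prod_comm' (t' := Finset.univ)
      (s' := fun j : Fin n => Finset.univ.filter fun i : Fin (n - 1) =>
        i ∈ compDescents α ∧ j.1 ≤ i.1) (by simp)]
    refine Finset.prod_congr rfl fun j _ => ?_
    rw [Finset.prod_const, tabExp_apply, rowOf_baseTableau, ← card_compDescents_ge]
  rw [e, monomial_eq, Finsupp.prod_fintype _ _ (by simp), C_1, one_mul]

theorem genBar_smul_xComp {i : Fin (n - 1)} (h : i ∉ compDescents α) :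
    genBar F i • xComp F α = 0 := by
  rw [mem_compDescents_iff, not_not] at h
  rw [xComp_eq_monomial]
  exact genBar_smul_monomial_eq (by simp only [tabExp_apply, rowOf_baseTableau, h])

theorem smul_baseTableau_of_smul_xComp {h : ZeroHecke F n} (hx : h • xComp F α = 0) :
    h • tab F (baseTableau α) = 0 := by
  have := smul_sub_tabMonomial_mem α F h (f := xComp F α) (v := tab F (baseTableau α)) (by
    rw [xComp_eq_monomial, tabMonomial_tab, sub_self]; exact Submodule.zero_mem _)
  rw [hx, zero_sub, Submodule.neg_mem_iff] at this
  exact eq_zero_of_tabMonomial_mem α F this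

-- Stated for any vector killed by the `π̄_i` with `i ∉ D(α)`, so that it serves both `x_α` and the
-- base tableau.
open Classical in
theorem sum_piBar_smul {V : Type*} [AddCommGroup V] [Module F V] [Module (ZeroHecke F n) V]
    [IsScalarTower F (ZeroHecke F n) V] (c : Equiv.Perm (Fin n) → F) {v : V}
    (hv : ∀ i, i ∉ compDescents α → genBar F i • v = 0) :
    (∑ w, c w • piBar F w) • v =
      ∑ w : {w : Equiv.Perm (Fin n) // permDescents w ⊆ compDescents α},
        c w.1 • piBar F w.1 • v := by
  rw [Finset.sum_smul, ← Finset.sum_subtype (Finset.univ.filter fun w : Equiv.Perm (Fin n) =>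
    permDescents w ⊆ compDescents α) (by simp) (fun w => c w • piBar F w • v)]
  simp only [smul_assoc]
  refine (Finset.sum_subset (Finset.filter_subset _ _) fun w _ hw => ?_).symm
  have hw' : ¬ permDescents w ⊆ compDescents α := by simpa using hw
  obtain ⟨i, h1, h2⟩ := Set.not_subset.1 hw'
  rw [piBar_smul_eq_zero h1 (hv i h2), smul_zero]

theorem smul_eq_zero_iff (h : ZeroHecke F n) :
    h • xComp F α = 0 ↔ h • tab F (baseTableau α) = 0 := by
  classical
  refine ⟨smul_baseTableau_of_smul_xComp α F, fun hx => ?_⟩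
  obtain ⟨c, rfl⟩ := exists_sum_piBar h
  rw [sum_piBar_smul α F c fun i => genBar_smul_baseTableau α F] at hx
  rw [sum_piBar_smul α F c fun i => genBar_smul_xComp α F]
  -- The remaining `π̄_w τ₀` are distinct basis tableaux, so every surviving coefficient vanishes.
  have hc := Fintype.linearIndependent_iff.1 (linearIndependent_piBar_smul_baseTableau α F)
    (fun w => c w.1) hx
  exact Finset.sum_eq_zero fun w _ => by rw [hc w, zero_smul]

/-- A relation says that `∑ c_w π̄_w` annihilates `x_α`; it then annihilates the base tableau, where
independence is known. -/
theorem linearIndependent_piBar_smul_xComp :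
    LinearIndependent F
      fun w : {w : Equiv.Perm (Fin n) // permDescents w ⊆ compDescents α} =>
        piBar F w.1 • xComp F α := by
  classical
  rw [Fintype.linearIndependent_iff]
  intro c hc
  refine Fintype.linearIndependent_iff.1 (linearIndependent_piBar_smul_baseTableau α F) c ?_
  simp only [← smul_assoc, ← Finset.sum_smul] at hc ⊢
  exact (smul_eq_zero_iff α F _).1 hc

/-- The basis `π̄_w x_α`, `D(w) ⊆ D(α)`, of the module generated by `x_α`. -/
theorem exists_basis_span_xComp :
    ∃ b : Module.Basis {w : Equiv.Perm (Fin n) // permDescents w ⊆ compDescents α} F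
        (Submodule.span (ZeroHecke F n) {xComp F α}),
      ∀ w, (b w : MvPolynomial (Fin n) F) = piBar F w.1 • xComp F α := by
  classical
  let b : {w : Equiv.Perm (Fin n) // permDescents w ⊆ compDescents α} →
      Submodule.span (ZeroHecke F n) {xComp F α} := fun w =>
    ⟨piBar F w.1 • xComp F α,
      Submodule.smul_mem _ _ (Submodule.mem_span_singleton_self _)⟩
  have hli : LinearIndependent F b := by
    have h := linearIndependent_piBar_smul_xComp α F
    exact LinearIndependent.of_comp
      ((Submodule.span (ZeroHecke F n) {xComp F α}).subtype.restrictScalars F) h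
  refine ⟨Module.Basis.mk hli ?_, fun w => by rw [Module.Basis.mk_apply]⟩
  rintro ⟨x, hx⟩ -
  obtain ⟨h, rfl⟩ := Submodule.mem_span_singleton.1 hx
  obtain ⟨c, rfl⟩ := exists_sum_piBar h
  rw [Submodule.mem_span_range_iff_exists_fun]
  refine ⟨fun w => c w.1, Subtype.ext ?_⟩
  refine Eq.trans ?_ (sum_piBar_smul α F c fun i => genBar_smul_xComp α F).symm
  exact map_sum ((Submodule.span (ZeroHecke F n) {xComp F α}).subtype.restrictScalars F) _ _

/-- The module generated by `x_α` is isomorphic to the module of tableaux. -/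
noncomputable def spanXCompEquiv :
    Submodule.span (ZeroHecke F n) {xComp F α} ≃ₗ[ZeroHecke F n] MModule F α :=
  let f := LinearMap.toSpanSingleton (ZeroHecke F n) _ (xComp F α)
  let g := LinearMap.toSpanSingleton (ZeroHecke F n) _ (tab F (baseTableau α))
  -- Both modules are the quotient of `H_n(0)` by this common annihilator.
  have hker : LinearMap.ker f = LinearMap.ker g :=
    Submodule.ext fun h => smul_eq_zero_iff α F h
  (LinearEquiv.ofEq _ _ (LinearMap.range_toSpanSingleton _).symm).trans <|
    f.quotKerEquivRange.symm.trans <| (Submodule.quotEquivOfEq _ _ hker).trans <|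
      g.quotKerEquivOfSurjective <| LinearMap.range_eq_top.1 <|
        (LinearMap.range_toSpanSingleton _).trans (span_baseTableau α F)

end Comparison
end HeckePoly

/-- A basis indexed by the permutations is an injective family, so distinctness of the `π̄_w x_α` is
included. -/
theorem mainTheorem11 (F : Type*) [Field F] (n : ℕ) (α : Composition n) :
    (∃ b : Module.Basis
          {w : Equiv.Perm (Fin n) // HeckePoly.permDescents w ⊆ HeckePoly.compDescents α} F
          (Submodule.span (HeckePoly.ZeroHecke F n) {HeckePoly.xComp F α}),
        ∀ w, (b w : MvPolynomial (Fin n) F) = HeckePoly.piBar F w.1 • HeckePoly.xComp F α) ∧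
      Nonempty (Submodule.span (HeckePoly.ZeroHecke F n) {HeckePoly.xComp F α}
        ≃ₗ[HeckePoly.ZeroHecke F n] HeckePoly.MModule F α) :=
  ⟨HeckePoly.exists_basis_span_xComp α F, ⟨HeckePoly.spanXCompEquiv α F⟩⟩
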